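/- Let $\Omega\subset\mathbb R^d$ be compact and convex, and let $\mu,\nu$ be probability measures with $\mu(\Omega^c)=\nu(\Omega^c)=0$ that are absolutely continuous with respect to Lebesgue measure; assume that the density of $\mu$ is essentially bounded, with supremum norm $\|\mu\|_\infty$. For a continuous $\phi:\Omega\to\mathbb R$ put $$\phi^c(x)=\inf_{y\in\Omega}\Big(\tfrac12|x-y|^2-\phi(y)\Big),\qquad J(\phi)=\int_\Omega\phi\,d\nu+\int_\Omega\phi^c\,d\mu,$$ and let $T_\phi(x)$ denote a minimizer of $y\mapsto\frac12|x-y|^2-\phi(y)$ over $\Omega$. Let $\dot H^1(\Omega)$ be the space of integrable $u:\Omega\to\mathbb R$ with $\int_\Omega u\,dx=0$ that have a square integrable weak gradient, with $\langle u,w\rangle_{\dot H^1}=\int_\Omega\nabla u\cdot\nabla w\,dx$. The gradient $\nabla_{\dot H^1}J(\phi)$ is the element $g\in\dot H^1(\Omega)$ such that $\frac{d}{dt}\big|_{t=0}J(\phi+th)=\langle g,h\rangle_{\dot H^1}$ for every $h\in\dot H^1(\Omega)$ that is continuous on $\Omega$. For probability measures $\rho_1,\rho_2$ on $\Omega$ put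 $\|\rho_2-\rho_1\|_{\dot H^{-1}}^2=\int_\Omega|\nabla w|^2\,dx$, where $w\in\dot H^1(\Omega)$ is the weak solution of $-\Delta w=\rho_2-\rho_1$ with zero Neumann boundary conditions, that is, $\langle w,h\rangle_{\dot H^1}=\int_\Omega h\,d\rho_2-\int_\Omega h\,d\rho_1$ for all $h\in\dot H^1(\Omega)$ continuous on $\Omega$; the norm is $+\infty$ if there is no solution. Let $\lambda>0$ and let $\mathcal S_\lambda$ be the set of functions $\phi$ that are continuous on $\Omega$ and twice differentiable in its interior, with $(1-\lambda^{-1})I\le D^2\phi(x)\le(1-\lambda)I$ for every interior point $x$. Suppose that for every $n$ we have $\phi_n,\phi_{n+1/2}\in\mathcal S_\lambda$, the pushforward $\rho_n=T_{\phi_n\#}\mu$ is absolutely continuous with respect to Lebesgue measure, the gradient $\nabla_{\dot H^1}J(\phi_n)$ exists, and, almost everywhere in $\Omega$, $$\phi_{n+1/2}=\phi_n+\sigma\nabla_{\dot H^1}J(\phi_n),\qquad \sigma=\|\mu\|_\infty^{-1}\lambda^{d+1}.$$ Then, for every $n$, $$J(\phi_{n+1/2})-J(\phi_n)\ \ge\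 \tfrac12\|\mu\|_\infty^{-1}\lambda^{d+1}\,\|\nabla_{\dot H^1}J(\phi_n)\|_{\dot H^1}^2 .$$ Moreover, for every $n$ for which $\rho_{n+1/2}=T_{\phi_{n+1/2}\#}\mu$ is also absolutely continuous with respect to Lebesgue measure, the three norms below are finite and $$\|\rho_{n+1/2}-\nu\|_{\dot H^{-1}}^2-\|\rho_n-\nu\|_{\dot H^{-1}}^2\ \le\ -\|\rho_{n+1/2}-\rho_n\|_{\dot H^{-1}}^2 .$$ -/

import Mathlib

open MeasureTheory Set Filter Topology
open scoped ENNReal ContDiff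

noncomputable section

namespace BackForth

/-- The Euclidean space of dimension `d`. -/
abbrev Space (d : ℕ) : Type := EuclideanSpace ℝ (Fin d)

variable {d : ℕ}

/-- The quadratic cost `c(x, y) = |x - y|² / 2`. -/
def quadCost (x y : Space d) : ℝ := (1 / 2) * ‖x - y‖ ^ 2

/-- The `c`-transform `φᶜ(x) = inf_{y ∈ Ω} (c(x, y) - φ(y))` for the quadratic cost. -/
def cTransform (Ω : Set (Space d)) (φ : Space d → ℝ) (x : Space d) : ℝ :=
  ⨅ y : Ω, (quadCost x (y : Space d) - φ y)

/-- The Kantorovich dual functional `J(φ) = ∫ φ dν + ∫ φᶜ dμ`. -/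
def dualJ (Ω : Set (Space d)) (μ ν : Measure (Space d)) (φ : Space d → ℝ) : ℝ :=
  (∫ y in Ω, φ y ∂ν) + ∫ x in Ω, cTransform Ω φ x ∂μ

open Classical in
/-- The map `T_φ`: `T_φ(x)` is a minimizer over `y ∈ Ω` of `c(x, y) - φ(y)`. For `φ` satisfying
the Hessian bounds below on a nonempty compact convex `Ω`, the minimizer exists and is unique for
every `x`. The default value `x` is used only where no minimizer exists. -/
def transportMap (Ω : Set (Space d)) (φ : Space d → ℝ) (x : Space d) : Space d :=
  if h : ∃ y ∈ Ω, IsMinOn (fun z => quadCost x z - φ z) Ω y then h.choose else x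

/-- The pushforward `ρ = T_φ # μ`. -/
def pushed (Ω : Set (Space d)) (μ : Measure (Space d)) (φ : Space d → ℝ) : Measure (Space d) :=
  μ.map (transportMap Ω φ)

/-- The set `S_λ`: functions that are continuous on `Ω`, twice differentiable in the interior of
`Ω`, with `(1 - λ⁻¹) I ≤ D²φ ≤ (1 - λ) I` there. -/
def HessianClass (Ω : Set (Space d)) (lam : ℝ) : Set (Space d → ℝ) :=
  {φ | ContinuousOn φ Ω ∧ ∀ x ∈ interior Ω,
    DifferentiableAt ℝ φ x ∧ DifferentiableAt ℝ (fderiv ℝ φ) x ∧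
    ∀ v : Space d,
      (1 - lam⁻¹) * ‖v‖ ^ 2 ≤ fderiv ℝ (fderiv ℝ φ) x v v ∧
      fderiv ℝ (fderiv ℝ φ) x v v ≤ (1 - lam) * ‖v‖ ^ 2}

/-- The supremum norm of the Lebesgue density of `μ`. -/
def densitySup (μ : Measure (Space d)) : ℝ≥0∞ :=
  essSup (μ.rnDeriv volume) volume

/-- An element of the homogeneous Sobolev space: an integrable function on `Ω` of mean zero,
together with its (almost everywhere unique) weak gradient, which is square integrable. -/
structure HDot1 (Ω : Set (Space d)) where
  /-- the function -/
  toFun : Space d → ℝ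
  /-- its weak gradient -/
  grad : Space d → Space d
  integrableOn : IntegrableOn toFun Ω volume
  mean_zero : ∫ x in Ω, toFun x = 0
  grad_memLp : MemLp grad 2 (volume.restrict Ω)
  weak_grad : ∀ η : Space d → ℝ, ContDiff ℝ ∞ η → HasCompactSupport η →
    tsupport η ⊆ interior Ω → ∀ v : Space d,
      ∫ x in Ω, toFun x * fderiv ℝ η x v = - ∫ x in Ω, inner ℝ (grad x) v * η x

/-- The inner product `∫_Ω ∇u · ∇w`. -/
def HDot1.innerProd {Ω : Set (Space d)} (u w : HDot1 Ω) : ℝ :=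
  ∫ x in Ω, inner ℝ (u.grad x) (w.grad x)

/-- The squared norm `∫_Ω |∇u|²`. -/
def HDot1.normSq {Ω : Set (Space d)} (u : HDot1 Ω) : ℝ :=
  ∫ x in Ω, ‖u.grad x‖ ^ 2

/-- `g` is the gradient of the functional `F` at `φ` in the homogeneous Sobolev space: the first
variation of `F` at `φ` in every direction `h` of that space that is continuous on `Ω` exists and
equals the inner product of `g` and `h`. (`F` acts on functions that are continuous on `Ω`.) -/
def IsHDot1Gradient {Ω : Set (Space d)} (F : (Space d → ℝ) → ℝ) (φ : Space d → ℝ)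
    (g : HDot1 Ω) : Prop :=
  ∀ h : HDot1 Ω, ContinuousOn h.toFun Ω →
    HasDerivAt (fun t : ℝ => F (fun x => φ x + t * h.toFun x)) (g.innerProd h) 0

/-- `w` is a weak solution of `-Δ w = ρ₂ - ρ₁` in `Ω` with zero Neumann boundary conditions: the
test functions do not have to vanish at the boundary. -/
def IsNeumannSolution {Ω : Set (Space d)} (w : HDot1 Ω) (ρ₁ ρ₂ : Measure (Space d)) : Prop :=
  ∀ h : HDot1 Ω, ContinuousOn h.toFun Ω →
    w.innerProd h = (∫ x in Ω, h.toFun x ∂ρ₂) - ∫ x in Ω, h.toFun x ∂ρ₁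

/-- The squared negative Sobolev norm of `ρ₂ - ρ₁`: the value `∫_Ω |∇w|²` for the solution `w` of
the Neumann problem `-Δ w = ρ₂ - ρ₁`. The solution is unique up to null sets, so that the infimum
is over a single value; it is `∞` exactly if there is no solution. -/
def hNegSq (Ω : Set (Space d)) (ρ₁ ρ₂ : Measure (Space d)) : ℝ≥0∞ :=
  ⨅ (w : HDot1 Ω) (_ : IsNeumannSolution w ρ₁ ρ₂), ENNReal.ofReal w.normSq

end BackForth


end

open BackForth

/-!
Write `u = |·|² / 2 - φ`, so that `lam ≤ D²u ≤ lam⁻¹` in the interior of `Ω`, and let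
`h = φ₁ - φ₀ = σ g` be the increment of a gradient step, `T₀`, `T₁` the transport maps,
`ρ₀`, `ρ₁` the pushforwards.

Convexity. The lower bound makes `c(x, ·) - φ` strongly convex on `Ω` (`growth_of_isMinOn`). So
minimizers are unique and `T_φ` is Lipschitz. The upper bound gives
`⟨T x - T x', x - x'⟩ ≥ lam |x - x'|²` as long as `T x` and `T x'` are interior (`cocoercive`);
the exceptional points are null, because the pushforward does not charge the boundary of the convex
set `Ω`. The estimate passes to the interpolations `(1 - s) T₀ + s T₁`, which therefore expand
distances by the factor `lam`, so that their laws have density at most `‖μ‖_∞ lam ^ (-d)`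
(`map_interpolation_le`, by way of Hausdorff measures).

Ascent. Since `J` lies below its linearization, its derivative in the direction `k` can only be
`∫ k dν - ∫ k dρ₀` (`innerProd_gradient`). The second order remainder of the `c`-transform at `x` is
at least `-|∇h (T₀ x)|² / (2 lam)` (`cTransform_remainder_ge`). Integration with the density bound
for `ρ₀` turns this into `-σ⁻¹ ‖∇h‖² / 2`, and `h = σ g` gives the first claim.

Contraction. For `k` in the Sobolev space and continuous, integrating `∇k` along the segments from
`T₀ x` to `T₁ x` yields
`|∫ k dρ₁ - ∫ k dρ₀|² ≤ ‖μ‖_∞ lam ^ (-d) ‖∇k‖² ∫ |T₁ - T₀|² dμ`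
(`HDot1.lintegral_sub_sq_le`; weakly differentiable `k` are approximated by mollification after a
contraction of `Ω` towards an interior point). The same estimate on `Ω × Ω` is the Poincaré
inequality, hence the Sobolev space is complete and the Riesz representation theorem provides a
solution `w` of the Neumann problem from `ρ₀` to `ρ₁` with
`‖w‖² ≤ ‖μ‖_∞ lam ^ (-d) ∫ |T₁ - T₀|² dμ`. Strong convexity at the two minimizers gives
`lam |T₁ - T₀|² ≤ h (T₁) - h (T₀)`, whose integral is `⟨w, h⟩ = σ ⟨w, g⟩`. Altogether
`‖w‖² ≤ ⟨w, g⟩`. As `-g` and `w - g` solve the Neumann problems from `ν` to `ρ₀` and from `ν` to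
`ρ₁`, the second claim is `‖w - g‖² - ‖g‖² ≤ -‖w‖²`. That `-g` has the least norm among the
solutions follows by testing with `h`, which is continuous.
-/

open BackForth

namespace BackForth

variable {d : ℕ} {Ω : Set (Space d)} {lam : ℝ} {φ φ₀ φ₁ : Space d → ℝ} {μ ν : Measure (Space d)}

/-! ### Maps that expand distances -/

/-- A map that expands distances on `X` by the factor `c` has a left inverse on its image that is
`c⁻¹`-Lipschitz, and Lipschitz maps control the Hausdorff measure. -/
theorem volume_preimage_le_of_expanding {S : Space d → Space d} {X : Set (Space d)} {c : ℝ}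
    (hc : 0 < c) (hS : ∀ x ∈ X, ∀ x' ∈ X, c * ‖x - x'‖ ≤ ‖S x - S x'‖) (A : Set (Space d)) :
    volume (S ⁻¹' A ∩ X) ≤ ENNReal.ofReal ((c ^ d)⁻¹) * volume A := by
  have hlip : LipschitzOnWith (Real.toNNReal c⁻¹) (Function.invFunOn S X) (S '' X) := by
    apply LipschitzOnWith.of_dist_le_mul
    intro a ha b hb
    have h1 := hS _ (Function.invFunOn_mem ha) _ (Function.invFunOn_mem hb)
    rw [Function.invFunOn_eq ha, Function.invFunOn_eq hb] at h1
    rw [Real.coe_toNNReal _ (by positivity), dist_eq_norm, dist_eq_norm,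
      inv_mul_eq_div, le_div_iff₀ hc]
    linarith
  have hinj : InjOn S X := by
    intro x hx x' hx' h
    have := hS x hx x' hx'
    rw [h, sub_self, norm_zero] at this
    have h0 : ‖x - x'‖ ≤ 0 := nonpos_of_mul_nonpos_right this hc
    simpa [sub_eq_zero] using h0
  have himg : S ⁻¹' A ∩ X ⊆ Function.invFunOn S X '' (A ∩ S '' X) := by
    rintro x ⟨hxA, hxX⟩
    refine ⟨S x, ⟨hxA, mem_image_of_mem S hxX⟩, ?_⟩
    exact hinj.leftInvOn_invFunOn hxX
  have hH := (hlip.mono (inter_subset_right (s := A))).hausdorffMeasure_image_le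
    (d := (d : ℝ)) (Nat.cast_nonneg d)
  have hHaar : (Measure.hausdorffMeasure (d : ℝ) : Measure (Space d)).IsAddHaarMeasure := by
    simpa using MeasureTheory.isAddHaarMeasure_hausdorffMeasure (E := EuclideanSpace ℝ (Fin d))
  have hvol := Measure.isAddLeftInvariant_eq_smul (volume : Measure (Space d))
    (Measure.hausdorffMeasure (d : ℝ))
  set a := Measure.addHaarScalarFactor (volume : Measure (Space d))
    (Measure.hausdorffMeasure (d : ℝ))
  have hcd : ((Real.toNNReal c⁻¹ : NNReal) : ℝ≥0∞) ^ (d : ℝ) = ENNReal.ofReal ((c ^ d)⁻¹) := by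
    rw [ENNReal.rpow_natCast, ← ENNReal.ofReal, ← ENNReal.ofReal_pow (by positivity), inv_pow]
  rw [hcd] at hH
  rw [hvol]
  simp only [Measure.smul_apply, ENNReal.smul_def, smul_eq_mul]
  calc (a : ℝ≥0∞) * _ ≤ a * (ENNReal.ofReal ((c ^ d)⁻¹) * Measure.hausdorffMeasure (d : ℝ) A) := by
        gcongr
        refine (measure_mono himg).trans (hH.trans ?_)
        gcongr
        exact inter_subset_left
    _ = _ := by ring

/-- The pushforward under a map that expands distances by the factor `c` has density at most `M / c ^ d`
if the original measure has density at most `M`. -/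
theorem map_le_of_expanding {S : Space d → Space d} {X Ω : Set (Space d)} {c : ℝ}
    {m : Measure (Space d)} {M : ℝ≥0∞} (hm : m ≤ M • volume) (hX : ∀ᵐ x ∂m, x ∈ X ∧ S x ∈ Ω)
    (hc : 0 < c) (hSm : Measurable S)
    (hS : ∀ x ∈ X, ∀ x' ∈ X, c * ‖x - x'‖ ≤ ‖S x - S x'‖) :
    m.map S ≤ (M * ENNReal.ofReal ((c ^ d)⁻¹)) • volume.restrict Ω := by
  refine Measure.le_iff.2 fun A hA => ?_
  rw [Measure.map_apply hSm hA, Measure.smul_apply, Measure.restrict_apply hA, smul_eq_mul]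
  calc m (S ⁻¹' A) ≤ m (S ⁻¹' (A ∩ Ω) ∩ X) := by
        refine measure_mono_ae ?_
        filter_upwards [hX] with x hx hxA using ⟨⟨hxA, hx.2⟩, hx.1⟩
    _ ≤ (M • volume) (S ⁻¹' (A ∩ Ω) ∩ X) := hm _
    _ = M * volume (S ⁻¹' (A ∩ Ω) ∩ X) := rfl
    _ ≤ M * (ENNReal.ofReal ((c ^ d)⁻¹) * volume (A ∩ Ω)) := by
        gcongr
        exact volume_preimage_le_of_expanding hc hS _
    _ = _ := by ring

theorem le_densitySup_smul {μ : Measure (Space d)} [IsFiniteMeasure μ] (hμ : μ ≪ volume) :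
    μ ≤ densitySup μ • volume := by
  conv_lhs => rw [← Measure.withDensity_rnDeriv_eq μ volume hμ]
  rw [← withDensity_const]
  exact withDensity_mono (ae_le_essSup (by isBoundedDefault))

theorem densitySup_ne_zero {μ : Measure (Space d)} [IsProbabilityMeasure μ] (hμ : μ ≪ volume) :
    densitySup μ ≠ 0 := by
  intro h
  have h1 := le_densitySup_smul hμ univ
  simp [h] at h1

/-- A convex set that carries an absolutely continuous probability measure is not contained in a
hyperplane. -/
theorem nonempty_interior_of_ac {Ω : Set (Space d)} (hΩ : Convex ℝ Ω) {μ : Measure (Space d)}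
    [IsProbabilityMeasure μ] (hμ : μ ≪ volume) (hsupp : μ Ωᶜ = 0) : (interior Ω).Nonempty := by
  by_contra h
  rw [not_nonempty_iff_eq_empty] at h
  have h0 : volume Ω = 0 := by
    refine measure_mono_null ?_ (hΩ.addHaar_frontier volume)
    rw [frontier, h, sdiff_empty]
    exact subset_closure
  have h1 : μ univ ≤ 0 := by
    rw [← union_compl_self Ω]
    exact (measure_union_le _ _).trans (by rw [hμ h0, hsupp, zero_add])
  simp at h1

/-! ### Consequences of the Hessian bounds -/

/-- Semiconcavity from the upper Hessian bound, along a segment in the interior. -/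
theorem semiconcave_interior (hΩ : Convex ℝ Ω) (hφ : φ ∈ HessianClass Ω lam) {y y' : Space d}
    (hy : y ∈ interior Ω) (hy' : y' ∈ interior Ω) {s : ℝ} (hs : s ∈ Icc (0 : ℝ) 1) :
    (1 - s) * φ y + s * φ y' - (1 - lam) / 2 * (s * (1 - s)) * ‖y' - y‖ ^ 2 ≤
      φ (y + s • (y' - y)) := by
  set v := y' - y with hv
  have hmem : ∀ r ∈ Icc (0 : ℝ) 1, y + r • v ∈ interior Ω := fun r hr =>
    hΩ.interior.add_smul_sub_mem hy hy' hr
  have hline : ∀ r : ℝ, HasDerivAt (fun r : ℝ => y + r • v) v r := fun r => by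
    simpa using ((hasDerivAt_id r).smul_const v).const_add y
  have h1 : ∀ r ∈ Icc (0 : ℝ) 1, HasDerivAt (fun r => φ (y + r • v)) (fderiv ℝ φ (y + r • v) v) r :=
    fun r hr => (hφ.2 _ (hmem r hr)).1.hasFDerivAt.comp_hasDerivAt r (hline r)
  have h2 : ∀ r ∈ Icc (0 : ℝ) 1, HasDerivAt (fun r => fderiv ℝ φ (y + r • v) v)
      (fderiv ℝ (fderiv ℝ φ) (y + r • v) v v) r := fun r hr => by
    have := (hφ.2 _ (hmem r hr)).2.1.hasFDerivAt.comp_hasDerivAt r (hline r)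
    simpa using this.clm_apply (hasDerivAt_const r v)
  have hconv : ConvexOn ℝ (Icc (0 : ℝ) 1)
      (fun r => (1 - lam) / 2 * ‖v‖ ^ 2 * r ^ 2 - φ (y + r • v)) := by
    refine convexOn_of_hasDerivWithinAt2_nonneg (convex_Icc 0 1)
      (f' := fun r => (1 - lam) * ‖v‖ ^ 2 * r - fderiv ℝ φ (y + r • v) v)
      (f'' := fun r => (1 - lam) * ‖v‖ ^ 2 - fderiv ℝ (fderiv ℝ φ) (y + r • v) v v) ?_ ?_ ?_ ?_
    · exact (by fun_prop : ContinuousOn (fun r : ℝ => (1 - lam) / 2 * ‖v‖ ^ 2 * r ^ 2) _).sub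
        fun r hr => (h1 r hr).continuousAt.continuousWithinAt
    · intro r hr
      have := ((hasDerivAt_pow 2 r).const_mul ((1 - lam) / 2 * ‖v‖ ^ 2)).sub
        (h1 r (interior_subset hr))
      refine (this.congr_deriv ?_).hasDerivWithinAt
      simp; ring
    · intro r hr
      have := ((hasDerivAt_id r).const_mul ((1 - lam) * ‖v‖ ^ 2)).sub
        (h2 r (interior_subset hr))
      exact (this.congr_deriv (by simp)).hasDerivWithinAt
    · intro r hr
      exact sub_nonneg.2 ((hφ.2 _ (hmem r (interior_subset hr))).2.2 v).2
  have := hconv.2 (left_mem_Icc.2 zero_le_one) (right_mem_Icc.2 zero_le_one)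
    (sub_nonneg.2 hs.2) hs.1 (by ring)
  simp only [smul_eq_mul, mul_zero, mul_one, zero_add, zero_smul, add_zero, one_smul, one_pow] at this
  have e : y + v = y' := by simp [hv]
  rw [e] at this
  nlinarith [this]

/-- Functions in the Hessian class are semiconcave on all of `Ω`, including the boundary. -/
theorem semiconcave (hΩ : Convex ℝ Ω) (hne : (interior Ω).Nonempty) (hφ : φ ∈ HessianClass Ω lam)
    {y y' : Space d} (hy : y ∈ Ω) (hy' : y' ∈ Ω) {s : ℝ} (hs : s ∈ Icc (0 : ℝ) 1) :
    (1 - s) * φ y + s * φ y' - (1 - lam) / 2 * (s * (1 - s)) * ‖y' - y‖ ^ 2 ≤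
      φ (y + s • (y' - y)) := by
  obtain ⟨z, hz⟩ := hne
  have key : ∀ p ∈ Ω, Tendsto (fun r : ℝ => p + r • (z - p)) (𝓝[>] 0) (𝓝[Ω] p) := by
    intro p hp
    refine tendsto_nhdsWithin_iff.2 ⟨?_, ?_⟩
    · have : Continuous (fun r : ℝ => p + r • (z - p)) := by fun_prop
      simpa using (this.tendsto 0).mono_left nhdsWithin_le_nhds
    · filter_upwards [Ioo_mem_nhdsGT (zero_lt_one (α := ℝ))] with r hr
      exact hΩ.add_smul_sub_mem hp (interior_subset hz) ⟨hr.1.le, hr.2.le⟩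
  have hm : y + s • (y' - y) ∈ Ω := hΩ.add_smul_sub_mem hy hy' hs
  have t1 := (hφ.1 y hy).tendsto.comp (key y hy)
  have t2 := (hφ.1 y' hy').tendsto.comp (key y' hy')
  have t3 := (hφ.1 _ hm).tendsto.comp (key _ hm)
  have c1 : Tendsto (fun r : ℝ => (1 - lam) / 2 * (s * (1 - s)) *
      ‖(y' + r • (z - y')) - (y + r • (z - y))‖ ^ 2) (𝓝[>] 0)
      (𝓝 ((1 - lam) / 2 * (s * (1 - s)) * ‖y' - y‖ ^ 2)) := by
    have : Continuous (fun r : ℝ => (1 - lam) / 2 * (s * (1 - s)) *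
      ‖(y' + r • (z - y')) - (y + r • (z - y))‖ ^ 2) := by fun_prop
    simpa using (this.tendsto 0).mono_left nhdsWithin_le_nhds
  refine le_of_tendsto_of_tendsto (((t1.const_mul (1 - s)).add (t2.const_mul s)).sub c1) t3 ?_
  filter_upwards [Ioo_mem_nhdsGT (zero_lt_one (α := ℝ))] with r hr
  have i1 := hΩ.add_smul_sub_mem_interior hy hz ⟨hr.1, hr.2.le⟩
  have i2 := hΩ.add_smul_sub_mem_interior hy' hz ⟨hr.1, hr.2.le⟩
  have := semiconcave_interior hΩ hφ i1 i2 hs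
  have e : y + r • (z - y) + s • (y' + r • (z - y') - (y + r • (z - y))) =
      y + s • (y' - y) + r • (z - (y + s • (y' - y))) := by module
  rw [e] at this
  exact this

/-- The quadratic cost minus a function of the Hessian class is `lam`-strongly convex, hence grows
quadratically away from its minimizer. -/
theorem growth_of_isMinOn (hΩ : Convex ℝ Ω) (hne : (interior Ω).Nonempty)
    (hφ : φ ∈ HessianClass Ω lam) {x y y' : Space d} (hy : y ∈ Ω) (hy' : y' ∈ Ω)
    (hmin : IsMinOn (fun z => quadCost x z - φ z) Ω y) :
    quadCost x y - φ y + lam / 2 * ‖y' - y‖ ^ 2 ≤ quadCost x y' - φ y' := by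
  have h1 : ∀ s ∈ Ioo (0 : ℝ) 1, quadCost x y - φ y + (1 - s) * (lam / 2 * ‖y' - y‖ ^ 2) ≤
      quadCost x y' - φ y' := by
    intro s hs
    have hsc := semiconcave hΩ hne hφ hy hy' ⟨hs.1.le, hs.2.le⟩
    have hm := isMinOn_iff.1 hmin _ (hΩ.add_smul_sub_mem hy hy' ⟨hs.1.le, hs.2.le⟩)
    have hq : quadCost x (y + s • (y' - y)) = (1 - s) * quadCost x y + s * quadCost x y' -
        1 / 2 * (s * (1 - s)) * ‖y' - y‖ ^ 2 := by
      have e1 : x - (y + s • (y' - y)) = (x - y) - s • (y' - y) := by module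
      have e2 : x - y' = (x - y) - (y' - y) := by module
      have n1 := norm_sub_sq_real (x - y) (s • (y' - y))
      have n2 := norm_sub_sq_real (x - y) (y' - y)
      rw [norm_smul, inner_smul_right, mul_pow, Real.norm_eq_abs, sq_abs] at n1
      unfold quadCost
      rw [e1, n1, e2, n2]
      ring
    simp only [hq] at hm
    have : 0 ≤ s * ((quadCost x y' - φ y') - (quadCost x y - φ y) -
        (1 - s) * (lam / 2 * ‖y' - y‖ ^ 2)) := by nlinarith
    linarith [nonneg_of_mul_nonneg_right this hs.1]
  have t : Tendsto (fun s : ℝ => quadCost x y - φ y + (1 - s) * (lam / 2 * ‖y' - y‖ ^ 2)) (𝓝[>] 0)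
      (𝓝 (quadCost x y - φ y + lam / 2 * ‖y' - y‖ ^ 2)) := by
    have : Continuous (fun s : ℝ => quadCost x y - φ y + (1 - s) * (lam / 2 * ‖y' - y‖ ^ 2)) := by
      fun_prop
    simpa using (this.tendsto 0).mono_left nhdsWithin_le_nhds
  refine le_of_tendsto t ?_
  filter_upwards [Ioo_mem_nhdsGT (zero_lt_one (α := ℝ))] with s hs using h1 s hs

/-- First order form of semiconcavity, at an interior point. -/
theorem le_first_order (hΩ : Convex ℝ Ω) (hne : (interior Ω).Nonempty)
    (hφ : φ ∈ HessianClass Ω lam) {y y' : Space d} (hy : y ∈ interior Ω) (hy' : y' ∈ Ω) :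
    φ y' ≤ φ y + fderiv ℝ φ y (y' - y) + (1 - lam) / 2 * ‖y' - y‖ ^ 2 := by
  have hd : HasDerivAt (fun s : ℝ => φ (y + s • (y' - y))) (fderiv ℝ φ y (y' - y)) 0 := by
    have hl : HasDerivAt (fun s : ℝ => y + s • (y' - y)) (y' - y) 0 := by
      simpa using ((hasDerivAt_id (0 : ℝ)).smul_const (y' - y)).const_add y
    have h0 : HasFDerivAt φ (fderiv ℝ φ y) (y + (0 : ℝ) • (y' - y)) := by
      simpa using (hφ.2 y hy).1.hasFDerivAt
    exact h0.comp_hasDerivAt 0 hl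
  have t1 := hd.tendsto_slope_zero_right
  have t2 : Tendsto (fun s : ℝ => φ y' - φ y - (1 - s) * ((1 - lam) / 2 * ‖y' - y‖ ^ 2)) (𝓝[>] 0)
      (𝓝 (φ y' - φ y - (1 - lam) / 2 * ‖y' - y‖ ^ 2)) := by
    have : Continuous (fun s : ℝ => φ y' - φ y - (1 - s) * ((1 - lam) / 2 * ‖y' - y‖ ^ 2)) := by
      fun_prop
    simpa using (this.tendsto 0).mono_left nhdsWithin_le_nhds
  have := le_of_tendsto_of_tendsto t2 t1 ?_
  · linarith
  filter_upwards [Ioo_mem_nhdsGT (zero_lt_one (α := ℝ))] with s hs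
  have hsc := semiconcave hΩ hne hφ (interior_subset hy) hy' ⟨hs.1.le, hs.2.le⟩
  simp only [zero_add, zero_smul, add_zero, smul_eq_mul]
  rw [inv_mul_eq_div, le_div_iff₀ hs.1]
  nlinarith

/-- Cocoercivity of the gradient of `|·|² / 2 - φ`: this is where the lower Hessian bound, the
symmetry of second derivatives and the mean value theorem enter. -/
theorem cocoercive (hΩ : Convex ℝ Ω) (hlam : 0 < lam) (hφ : φ ∈ HessianClass Ω lam)
    {x x' y y' : Space d} (hy : y ∈ interior Ω) (hy' : y' ∈ interior Ω)
    (hx : ∀ v, fderiv ℝ φ y v = inner ℝ (y - x) v)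
    (hx' : ∀ v, fderiv ℝ φ y' v = inner ℝ (y' - x') v) :
    lam * ‖x - x'‖ ^ 2 ≤ inner ℝ (x - x') (y - y') := by
  set D := x - x' with hD
  set v := y - y' with hv
  set w := v - (2 * lam) • D with hw
  have hmem : ∀ r ∈ Icc (0 : ℝ) 1, y' + r • v ∈ interior Ω := fun r hr =>
    hΩ.interior.add_smul_sub_mem hy' hy hr
  have hline : ∀ r : ℝ, HasDerivAt (fun r : ℝ => y' + r • v) v r := fun r => by
    simpa using ((hasDerivAt_id r).smul_const v).const_add y'
  -- monotonicity of `e` is the claim: `e 1 - e 0 = ⟨D, v⟩ - lam |D|²`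
  let e : ℝ → ℝ := fun r => inner ℝ (y' + r • v) w - fderiv ℝ φ (y' + r • v) w + r * (lam * ‖D‖ ^ 2)
  have hder : ∀ r ∈ Icc (0 : ℝ) 1, HasDerivAt e
      (inner ℝ v w - fderiv ℝ (fderiv ℝ φ) (y' + r • v) v w + lam * ‖D‖ ^ 2) r := by
    intro r hr
    have h2 : HasDerivAt (fun r => fderiv ℝ φ (y' + r • v) w)
        (fderiv ℝ (fderiv ℝ φ) (y' + r • v) v w) r := by
      have := (hφ.2 _ (hmem r hr)).2.1.hasFDerivAt.comp_hasDerivAt r (hline r)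
      simpa using this.clm_apply (hasDerivAt_const r w)
    have h3 : HasDerivAt (fun r : ℝ => inner ℝ (y' + r • v) w) (inner ℝ v w) r := by
      simpa using (hline r).inner ℝ (hasDerivAt_const r w)
    exact ((h3.sub h2).add ((hasDerivAt_id r).mul_const (lam * ‖D‖ ^ 2))).congr_deriv (by simp)
  have hmono : MonotoneOn e (Icc 0 1) := by
    refine monotoneOn_of_deriv_nonneg (convex_Icc 0 1)
      (fun r hr => (hder r hr).continuousAt.continuousWithinAt)
      (fun r hr => (hder r (interior_subset hr)).differentiableAt.differentiableWithinAt) ?_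
    intro r hr
    replace hr := interior_subset hr
    rw [(hder r hr).deriv]
    obtain ⟨-, h2, hb⟩ := hφ.2 _ (hmem r hr)
    set H := fderiv ℝ (fderiv ℝ φ) (y' + r • v)
    have hsymm : H v D = H D v := second_derivative_symmetric_of_eventually
      (by filter_upwards [isOpen_interior.mem_nhds (hmem r hr)] with z hz
          using (hφ.2 z hz).1.hasFDerivAt) h2.hasFDerivAt v D
    have b1 := (hb D).1
    have b2 := (hb (v - lam • D)).2
    have b3 : lam ^ 2 * ((1 - lam⁻¹) * ‖D‖ ^ 2) ≤ lam ^ 2 * H D D := by gcongr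
    have b4 : lam ^ 2 * ((1 - lam⁻¹) * ‖D‖ ^ 2) = lam ^ 2 * ‖D‖ ^ 2 - lam * ‖D‖ ^ 2 := by
      field_simp
    -- the derivative dominates the Hessian form of `u` at `v - lam • D`, which is nonnegative
    have b5 : 0 ≤ lam * ‖v - lam • D‖ ^ 2 := by positivity
    have b6 : ‖v - lam • D‖ ^ 2 = ‖v‖ ^ 2 - 2 * lam * inner ℝ v D + lam ^ 2 * ‖D‖ ^ 2 := by
      rw [norm_sub_sq_real, inner_smul_right, norm_smul, mul_pow, Real.norm_eq_abs, sq_abs]; ring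
    simp only [hw, map_sub, map_smul, sub_apply, smul_apply,
      inner_sub_right, inner_smul_right, real_inner_self_eq_norm_sq, smul_eq_mul, ← hsymm] at b2 ⊢
    nlinarith
  have hfin := hmono (left_mem_Icc.2 zero_le_one) (right_mem_Icc.2 zero_le_one) zero_le_one
  have ey : y' + v = y := by simp [hv]
  simp only [e, zero_smul, add_zero, one_smul, zero_mul, one_mul, ey, hx, hx', hw, inner_sub_right,
    inner_smul_right] at hfin
  have e1 : inner ℝ (y - x) v = inner ℝ y v - inner ℝ x v := inner_sub_left ..
  have e2 : inner ℝ (y' - x') v = inner ℝ y' v - inner ℝ x' v := inner_sub_left ..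
  have e3 : inner ℝ (y - x) D = inner ℝ y D - inner ℝ x D := inner_sub_left ..
  have e4 : inner ℝ (y' - x') D = inner ℝ y' D - inner ℝ x' D := inner_sub_left ..
  have e5 : inner ℝ D v = inner ℝ x v - inner ℝ x' v := inner_sub_left ..
  have e6 : ‖D‖ ^ 2 = inner ℝ x D - inner ℝ x' D := by
    rw [← real_inner_self_eq_norm_sq, ← inner_sub_left]
  have e7 : lam * ‖D‖ ^ 2 = lam * (inner ℝ x D - inner ℝ x' D) := by rw [e6]
  rw [e1, e2, e3, e4] at hfin
  rw [e5]
  linarith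

/-! ### The transport map and the `c`-transform -/

theorem continuous_quadCost_left (x : Space d) : Continuous (quadCost x) := by
  unfold quadCost; fun_prop

theorem exists_isMinOn (hΩ : IsCompact Ω) (hne : Ω.Nonempty) (hφ : ContinuousOn φ Ω)
    (x : Space d) : ∃ y ∈ Ω, IsMinOn (fun z => quadCost x z - φ z) Ω y :=
  hΩ.exists_isMinOn hne ((continuous_quadCost_left x).continuousOn.sub hφ)

theorem transportMap_mem (hΩ : IsCompact Ω) (hne : Ω.Nonempty) (hφ : ContinuousOn φ Ω)
    (x : Space d) : transportMap Ω φ x ∈ Ω := by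
  have h := exists_isMinOn hΩ hne hφ x
  rw [transportMap, dif_pos h]
  exact h.choose_spec.1

theorem transportMap_isMinOn (hΩ : IsCompact Ω) (hne : Ω.Nonempty) (hφ : ContinuousOn φ Ω)
    (x : Space d) : IsMinOn (fun z => quadCost x z - φ z) Ω (transportMap Ω φ x) := by
  have h := exists_isMinOn hΩ hne hφ x
  rw [transportMap, dif_pos h]
  exact h.choose_spec.2

theorem cTransform_le (hΩ : IsCompact Ω) (hφ : ContinuousOn φ Ω) (x : Space d) {y : Space d}
    (hy : y ∈ Ω) : cTransform Ω φ x ≤ quadCost x y - φ y := by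
  obtain ⟨z, hz, hmin⟩ := exists_isMinOn hΩ ⟨y, hy⟩ hφ x
  refine ciInf_le (f := fun y : Ω => quadCost x (y : Space d) - φ y) ⟨quadCost x z - φ z, ?_⟩ ⟨y, hy⟩
  rintro _ ⟨w, rfl⟩
  exact isMinOn_iff.1 hmin w w.2

theorem cTransform_eq (hΩ : IsCompact Ω) (hne : Ω.Nonempty) (hφ : ContinuousOn φ Ω) (x : Space d) :
    cTransform Ω φ x = quadCost x (transportMap Ω φ x) - φ (transportMap Ω φ x) := by
  refine le_antisymm (cTransform_le hΩ hφ x (transportMap_mem hΩ hne hφ x)) ?_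
  have : Nonempty Ω := hne.to_subtype
  exact le_ciInf fun y => isMinOn_iff.1 (transportMap_isMinOn hΩ hne hφ x) y y.2

/-- Strong convexity at two minimizers: the inverse of `T_φ` is strongly monotone, and `T_φ` is
`lam⁻¹`-Lipschitz. -/
theorem inner_transportMap_ge (hΩ : IsCompact Ω) (hconv : Convex ℝ Ω) (hne : (interior Ω).Nonempty)
    (hφ : φ ∈ HessianClass Ω lam) (x x' : Space d) :
    lam * ‖transportMap Ω φ x - transportMap Ω φ x'‖ ^ 2 ≤
      inner ℝ (x - x') (transportMap Ω φ x - transportMap Ω φ x') := by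
  have hne' := hne.mono interior_subset
  have hm := transportMap_mem hΩ hne' hφ.1
  have hmin := transportMap_isMinOn hΩ hne' hφ.1
  set y := transportMap Ω φ x
  set y' := transportMap Ω φ x'
  have h1 := growth_of_isMinOn hconv hne hφ (hm x) (hm x') (hmin x)
  have h2 := growth_of_isMinOn hconv hne hφ (hm x') (hm x) (hmin x')
  rw [norm_sub_rev] at h1
  have e : inner ℝ (x - x') (y - y') =
      quadCost x y' - quadCost x y + (quadCost x' y - quadCost x' y') := by
    simp only [quadCost, norm_sub_sq_real, inner_sub_left, inner_sub_right]
    ring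
  linarith

theorem continuous_transportMap (hΩ : IsCompact Ω) (hconv : Convex ℝ Ω)
    (hne : (interior Ω).Nonempty) (hlam : 0 < lam) (hφ : φ ∈ HessianClass Ω lam) :
    Continuous (transportMap Ω φ) := by
  refine (LipschitzWith.of_dist_le_mul (K := Real.toNNReal lam⁻¹) fun x x' => ?_).continuous
  rw [dist_eq_norm, dist_eq_norm, Real.coe_toNNReal _ (by positivity), inv_mul_eq_div,
    le_div_iff₀ hlam]
  have h := (inner_transportMap_ge hΩ hconv hne hφ x x').trans (real_inner_le_norm _ _)
  rcases (norm_nonneg (transportMap Ω φ x - transportMap Ω φ x')).eq_or_lt with h0 | h0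
  · rw [← h0, zero_mul]; exact norm_nonneg _
  · nlinarith

theorem continuous_comp_transportMap {k : Space d → ℝ} (hΩ : IsCompact Ω) (hconv : Convex ℝ Ω)
    (hne : (interior Ω).Nonempty) (hlam : 0 < lam) (hφ : φ ∈ HessianClass Ω lam)
    (hk : ContinuousOn k Ω) : Continuous (fun x => k (transportMap Ω φ x)) :=
  hk.comp_continuous (continuous_transportMap hΩ hconv hne hlam hφ)
    (transportMap_mem hΩ (hne.mono interior_subset) hφ.1)

/-- The `c`-transform of every continuous function is locally Lipschitz; no Hessian bounds are
needed, so that this applies to perturbations of `φ` in arbitrary directions. -/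
theorem continuous_cTransform (hΩ : IsCompact Ω) (hne : Ω.Nonempty) (hφ : ContinuousOn φ Ω) :
    Continuous (cTransform Ω φ) := by
  obtain ⟨R, hR⟩ := hΩ.isBounded.exists_norm_le
  have key : ∀ x x' : Space d, cTransform Ω φ x - cTransform Ω φ x' ≤
      1 / 2 * (‖x - x'‖ * (‖x + x'‖ + 2 * R)) := by
    intro x x'
    have hm := transportMap_mem hΩ hne hφ x'
    have h1 := cTransform_le hΩ hφ x hm
    rw [cTransform_eq hΩ hne hφ x']
    set y := transportMap Ω φ x'
    have e : quadCost x y - quadCost x' y = 1 / 2 * inner ℝ (x - x') (x + x' - (2 : ℝ) • y) := by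
      simp only [quadCost, norm_sub_sq_real, inner_sub_left, inner_sub_right, inner_add_right,
        inner_smul_right, real_inner_self_eq_norm_sq, real_inner_comm x x']
      ring
    have h2 : inner ℝ (x - x') (x + x' - (2 : ℝ) • y) ≤ ‖x - x'‖ * (‖x + x'‖ + 2 * R) := by
      refine (real_inner_le_norm _ _).trans ?_
      gcongr
      refine (norm_sub_le _ _).trans ?_
      rw [norm_smul, Real.norm_eq_abs, abs_two]
      gcongr
      exact hR _ hm
    linarith
  refine continuous_iff_continuousAt.2 fun x => ?_
  refine tendsto_iff_norm_sub_tendsto_zero.2 ?_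
  have ht : Tendsto (fun x' : Space d => 1 / 2 * (‖x' - x‖ * (‖x' + x‖ + 2 * R))) (𝓝 x) (𝓝 0) := by
    have : Continuous (fun x' : Space d => 1 / 2 * (‖x' - x‖ * (‖x' + x‖ + 2 * R))) := by fun_prop
    simpa using this.tendsto x
  refine squeeze_zero (fun _ => norm_nonneg _) (fun x' => ?_) ht
  rw [Real.norm_eq_abs, abs_le]
  have h1 := key x' x
  have h2 := key x x'
  rw [norm_sub_rev, add_comm x x'] at h2
  exact ⟨by linarith, h1⟩

/-- Optimality condition at an interior minimizer. -/
theorem fderiv_transportMap (hΩ : IsCompact Ω) (hφ : φ ∈ HessianClass Ω lam) {x : Space d}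
    (hx : transportMap Ω φ x ∈ interior Ω) (v : Space d) :
    fderiv ℝ φ (transportMap Ω φ x) v = inner ℝ (transportMap Ω φ x - x) v := by
  set y := transportMap Ω φ x with hy
  have hmin := transportMap_isMinOn hΩ ⟨y, interior_subset hx⟩ hφ.1 x
  have hloc : IsLocalMin (fun z => quadCost x z - φ z) y :=
    hmin.isLocalMin (mem_interior_iff_mem_nhds.1 hx)
  have hq : HasFDerivAt (quadCost x) ((innerSL ℝ) (y - x)) y := by
    have h1 : HasFDerivAt (fun z : Space d => x - z) (-ContinuousLinearMap.id ℝ (Space d)) y := by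
      simpa using (hasFDerivAt_id y).const_sub x
    have := (h1.norm_sq).const_mul (1 / 2 : ℝ)
    refine this.congr_fderiv ?_
    ext w
    simp
  have h0 := hloc.hasFDerivAt_eq_zero (hq.sub (hφ.2 y hx).1.hasFDerivAt)
  have := congrArg (fun L : Space d →L[ℝ] ℝ => L v) h0
  simp only [sub_apply, zero_apply, innerSL_apply_apply] at this
  linarith

/-- An absolutely continuous pushforward does not charge the boundary of the convex set `Ω`. -/
theorem ae_transportMap_mem_interior (hΩ : IsCompact Ω) (hconv : Convex ℝ Ω)
    (hne : (interior Ω).Nonempty) (hlam : 0 < lam) (hφ : φ ∈ HessianClass Ω lam)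
    (hρ : pushed Ω μ φ ≪ volume) : ∀ᵐ x ∂μ, transportMap Ω φ x ∈ interior Ω := by
  have h1 := hρ (hconv.addHaar_frontier volume)
  have hc := continuous_transportMap hΩ hconv hne hlam hφ
  rw [pushed, Measure.map_apply hc.measurable isClosed_frontier.measurableSet] at h1
  filter_upwards [compl_mem_ae_iff.2 h1] with x hx
  by_contra hxi
  exact hx ⟨subset_closure (transportMap_mem hΩ (hne.mono interior_subset) hφ.1 x), hxi⟩

/-- The law of the displacement interpolation `(1 - s) T₀ + s T₁` has density at most
`‖μ‖_∞ / lam ^ d`: both maps expand distances in the sense of `cocoercive`. -/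
theorem map_interpolation_le [IsFiniteMeasure μ] (hΩ : IsCompact Ω) (hconv : Convex ℝ Ω)
    (hne : (interior Ω).Nonempty) (hlam : 0 < lam) (hφ₀ : φ₀ ∈ HessianClass Ω lam)
    (hφ₁ : φ₁ ∈ HessianClass Ω lam) (hμ : μ ≪ volume) (hρ₀ : pushed Ω μ φ₀ ≪ volume)
    (hρ₁ : pushed Ω μ φ₁ ≪ volume) {s : ℝ} (hs : s ∈ Icc (0 : ℝ) 1) :
    μ.map (fun x => (1 - s) • transportMap Ω φ₀ x + s • transportMap Ω φ₁ x) ≤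
      (densitySup μ * ENNReal.ofReal ((lam ^ d)⁻¹)) • volume.restrict Ω := by
  have hc₀ := continuous_transportMap hΩ hconv hne hlam hφ₀
  have hc₁ := continuous_transportMap hΩ hconv hne hlam hφ₁
  refine map_le_of_expanding
    (X := {x | transportMap Ω φ₀ x ∈ interior Ω ∧ transportMap Ω φ₁ x ∈ interior Ω})
    (le_densitySup_smul hμ) ?_ hlam (by fun_prop) ?_
  · filter_upwards [ae_transportMap_mem_interior hΩ hconv hne hlam hφ₀ hρ₀,
      ae_transportMap_mem_interior hΩ hconv hne hlam hφ₁ hρ₁] with x h0 h1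
    exact ⟨⟨h0, h1⟩, hconv (interior_subset h0) (interior_subset h1) (sub_nonneg.2 hs.2) hs.1
      (by ring)⟩
  · intro x hx x' hx'
    have b0 := cocoercive hconv hlam hφ₀ hx.1 hx'.1 (fderiv_transportMap hΩ hφ₀ hx.1)
      (fderiv_transportMap hΩ hφ₀ hx'.1)
    have b1 := cocoercive hconv hlam hφ₁ hx.2 hx'.2 (fderiv_transportMap hΩ hφ₁ hx.2)
      (fderiv_transportMap hΩ hφ₁ hx'.2)
    set a := transportMap Ω φ₀ x - transportMap Ω φ₀ x' with ha
    set b := transportMap Ω φ₁ x - transportMap Ω φ₁ x' with hb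
    have e : (1 - s) • transportMap Ω φ₀ x + s • transportMap Ω φ₁ x -
        ((1 - s) • transportMap Ω φ₀ x' + s • transportMap Ω φ₁ x') = (1 - s) • a + s • b := by
      rw [ha, hb]; module
    rw [e]
    have h1 : lam * ‖x - x'‖ ^ 2 ≤ inner ℝ (x - x') ((1 - s) • a + s • b) := by
      rw [inner_add_right, inner_smul_right, inner_smul_right]
      nlinarith [mul_le_mul_of_nonneg_left b0 (sub_nonneg.2 hs.2),
        mul_le_mul_of_nonneg_left b1 hs.1]
    have h2 := h1.trans (real_inner_le_norm _ _)
    rcases (norm_nonneg (x - x')).eq_or_lt with h0 | h0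
    · rw [← h0, mul_zero]; exact norm_nonneg _
    · nlinarith

theorem pushed_le [IsFiniteMeasure μ] (hΩ : IsCompact Ω) (hconv : Convex ℝ Ω)
    (hne : (interior Ω).Nonempty) (hlam : 0 < lam) (hφ : φ ∈ HessianClass Ω lam)
    (hμ : μ ≪ volume) (hρ : pushed Ω μ φ ≪ volume) :
    pushed Ω μ φ ≤ (densitySup μ * ENNReal.ofReal ((lam ^ d)⁻¹)) • volume.restrict Ω := by
  simpa using! map_interpolation_le hΩ hconv hne hlam hφ hφ hμ hρ hρ (s := 0) (by simp)

theorem setIntegral_pushed {k : Space d → ℝ} (hΩ : IsCompact Ω) (hconv : Convex ℝ Ω)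
    (hne : (interior Ω).Nonempty) (hlam : 0 < lam) (hφ : φ ∈ HessianClass Ω lam)
    (hk : ContinuousOn k Ω) :
    ∫ y in Ω, k y ∂(pushed Ω μ φ) = ∫ x, k (transportMap Ω φ x) ∂μ := by
  have hc := continuous_transportMap hΩ hconv hne hlam hφ
  have hp : (transportMap Ω φ) ⁻¹' Ω = univ :=
    eq_univ_of_forall (transportMap_mem hΩ (hne.mono interior_subset) hφ.1)
  have hr : (pushed Ω μ φ).restrict Ω = pushed Ω μ φ := by
    rw [pushed, Measure.restrict_map hc.measurable hΩ.measurableSet, hp, Measure.restrict_univ]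
  have hsm : AEStronglyMeasurable k ((pushed Ω μ φ).restrict Ω) :=
    hk.aestronglyMeasurable hΩ.measurableSet
  rw [hr] at hsm ⊢
  exact integral_map hc.aemeasurable hsm

/-- Difference of the two minimizers, estimated by the difference of the potentials. -/
theorem sub_transportMap_ge (hΩ : IsCompact Ω) (hconv : Convex ℝ Ω)
    (hne : (interior Ω).Nonempty) (hφ₀ : φ₀ ∈ HessianClass Ω lam)
    (hφ₁ : φ₁ ∈ HessianClass Ω lam) (x : Space d) :
    lam * ‖transportMap Ω φ₁ x - transportMap Ω φ₀ x‖ ^ 2 ≤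
      (φ₁ (transportMap Ω φ₁ x) - φ₀ (transportMap Ω φ₁ x)) -
        (φ₁ (transportMap Ω φ₀ x) - φ₀ (transportMap Ω φ₀ x)) := by
  have hne' := hne.mono interior_subset
  have m0 := transportMap_mem hΩ hne' hφ₀.1 x
  have m1 := transportMap_mem hΩ hne' hφ₁.1 x
  have h0 := growth_of_isMinOn hconv hne hφ₀ m0 m1 (transportMap_isMinOn hΩ hne' hφ₀.1 x)
  have h1 := growth_of_isMinOn hconv hne hφ₁ m1 m0 (transportMap_isMinOn hΩ hne' hφ₁.1 x)
  rw [norm_sub_rev] at h1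
  linarith

/-- Pointwise form of the ascent inequality: the second order remainder of the `c`-transform is
controlled by the gradient of the increment at `T₀ x`. -/
theorem cTransform_remainder_ge (hΩ : IsCompact Ω) (hconv : Convex ℝ Ω)
    (hlam : 0 < lam) (hφ₀ : φ₀ ∈ HessianClass Ω lam)
    (hφ₁ : φ₁ ∈ HessianClass Ω lam) {x : Space d} (hx : transportMap Ω φ₀ x ∈ interior Ω) :
    -(1 / (2 * lam)) * ‖fderiv ℝ (fun z => φ₁ z - φ₀ z) (transportMap Ω φ₀ x)‖ ^ 2 ≤
      cTransform Ω φ₁ x - cTransform Ω φ₀ x +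
        (φ₁ (transportMap Ω φ₀ x) - φ₀ (transportMap Ω φ₀ x)) := by
  have hne : (interior Ω).Nonempty := ⟨_, hx⟩
  have hne' := hne.mono interior_subset
  have m1 := transportMap_mem hΩ hne' hφ₁.1 x
  rw [cTransform_eq hΩ hne' hφ₀.1, cTransform_eq hΩ hne' hφ₁.1]
  have hfo := le_first_order hconv hne hφ₁ hx m1
  have hopt := fderiv_transportMap hΩ hφ₀ hx
  set y := transportMap Ω φ₀ x
  set y' := transportMap Ω φ₁ x
  have hsub : fderiv ℝ (fun z => φ₁ z - φ₀ z) y = fderiv ℝ φ₁ y - fderiv ℝ φ₀ y :=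
    fderiv_fun_sub (hφ₁.2 y hx).1 (hφ₀.2 y hx).1
  have hn := ContinuousLinearMap.le_opNorm (fderiv ℝ (fun z => φ₁ z - φ₀ z) y) (y' - y)
  set N := ‖fderiv ℝ (fun z => φ₁ z - φ₀ z) y‖
  have hle : fderiv ℝ φ₁ y (y' - y) ≤ inner ℝ (y - x) (y' - y) + N * ‖y' - y‖ := by
    have := (Real.le_norm_self _).trans hn
    rw [hsub, sub_apply, hopt] at this
    linarith
  have hq : quadCost x y' - quadCost x y =
      inner ℝ (y - x) (y' - y) + 1 / 2 * ‖y' - y‖ ^ 2 := by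
    have n1 := norm_add_sq_real (y - x) (y' - y)
    have e : y - x + (y' - y) = -(x - y') := by abel
    rw [e, norm_neg] at n1
    unfold quadCost
    rw [n1, norm_sub_rev x y]
    ring
  have hsq : 0 ≤ 1 / (2 * lam) * (N - lam * ‖y' - y‖) ^ 2 := by positivity
  have hexp : 1 / (2 * lam) * (N - lam * ‖y' - y‖) ^ 2 =
      1 / (2 * lam) * N ^ 2 - N * ‖y' - y‖ + lam / 2 * ‖y' - y‖ ^ 2 := by
    field_simp
    ring
  linarith

/-! ### First variation and ascent of the dual functional -/

theorem restrict_eq_self_of_compl_null (hμ : μ Ωᶜ = 0) : μ.restrict Ω = μ :=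
  Measure.restrict_eq_self_of_ae_mem (mem_ae_iff.2 hμ)

theorem integrable_of_continuous [IsFiniteMeasure μ] (hΩ : IsCompact Ω) (hμ : μ Ωᶜ = 0)
    {f : Space d → ℝ} (hf : Continuous f) : Integrable f μ := by
  rw [← restrict_eq_self_of_compl_null hμ]
  exact hf.continuousOn.integrableOn_compact hΩ

/-- `J` lies below its linearization: use the old minimizer `T_φ x` as competitor in the
`c`-transform of the perturbed potential. -/
theorem dualJ_add_le [IsFiniteMeasure μ] [IsFiniteMeasure ν] (hΩ : IsCompact Ω)
    (hconv : Convex ℝ Ω) (hne : (interior Ω).Nonempty) (hlam : 0 < lam)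
    (hφ : φ ∈ HessianClass Ω lam) (hμ : μ Ωᶜ = 0) {k : Space d → ℝ} (hk : ContinuousOn k Ω)
    (t : ℝ) :
    dualJ Ω μ ν (fun x => φ x + t * k x) ≤ dualJ Ω μ ν φ +
      t * ((∫ x in Ω, k x ∂ν) - ∫ x in Ω, k x ∂(pushed Ω μ φ)) := by
  have hne' := hne.mono interior_subset
  have hk' : ContinuousOn (fun x => φ x + t * k x) Ω := hφ.1.add (continuousOn_const.mul hk)
  have hres := restrict_eq_self_of_compl_null hμ
  rw [setIntegral_pushed hΩ hconv hne hlam hφ hk, dualJ, dualJ]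
  have i1 := integrable_of_continuous hΩ hμ (continuous_cTransform hΩ hne' hk')
  have i2 := integrable_of_continuous hΩ hμ (continuous_cTransform hΩ hne' hφ.1)
  have i3 := integrable_of_continuous hΩ hμ (continuous_comp_transportMap hΩ hconv hne hlam hφ hk)
  have e1 : ∫ x in Ω, φ x + t * k x ∂ν = (∫ x in Ω, φ x ∂ν) + t * ∫ x in Ω, k x ∂ν := by
    rw [integral_add (hφ.1.integrableOn_compact hΩ)
      ((hk.integrableOn_compact hΩ).const_mul t), integral_const_mul]
  have e2 : ∫ x in Ω, cTransform Ω (fun x => φ x + t * k x) x ∂μ ≤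
      (∫ x, cTransform Ω φ x ∂μ) - t * ∫ x, k (transportMap Ω φ x) ∂μ := by
    rw [hres, ← integral_const_mul, ← integral_sub i2 (i3.const_mul t)]
    refine integral_mono i1 (i2.sub (i3.const_mul t)) fun x => ?_
    have h1 := cTransform_le hΩ hk' x (transportMap_mem hΩ hne' hφ.1 x)
    have h2 := cTransform_eq hΩ hne' hφ.1 x
    linarith
  rw [hres] at e2 ⊢
  linarith

/-- The first variation of `J` at `φ` is the integration against `ν - ρ`. Since `J` lies below its
linearization, differentiability alone determines the derivative. -/
theorem innerProd_gradient [IsFiniteMeasure μ] [IsFiniteMeasure ν] (hΩ : IsCompact Ω)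
    (hconv : Convex ℝ Ω) (hne : (interior Ω).Nonempty) (hlam : 0 < lam)
    (hφ : φ ∈ HessianClass Ω lam) (hμ : μ Ωᶜ = 0) {g : HDot1 Ω}
    (hg : IsHDot1Gradient (dualJ Ω μ ν) φ g) (k : HDot1 Ω) (hk : ContinuousOn k.toFun Ω) :
    g.innerProd k = (∫ x in Ω, k.toFun x ∂ν) - ∫ x in Ω, k.toFun x ∂(pushed Ω μ φ) := by
  set a := (∫ x in Ω, k.toFun x ∂ν) - ∫ x in Ω, k.toFun x ∂(pushed Ω μ φ)
  have h1 : HasDerivAt (fun t : ℝ => dualJ Ω μ ν (fun x => φ x + t * k.toFun x) - t * a)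
      (g.innerProd k - a) 0 := by
    simpa using! (hg k hk).sub ((hasDerivAt_id (0 : ℝ)).mul_const a)
  have h2 : IsLocalMax (fun t : ℝ => dualJ Ω μ ν (fun x => φ x + t * k.toFun x) - t * a) 0 := by
    refine Eventually.of_forall fun t => ?_
    have := dualJ_add_le (ν := ν) hΩ hconv hne hlam hφ hμ hk t
    simp only [zero_mul, add_zero, sub_zero]
    linarith
  linarith [h2.hasDerivAt_eq_zero h1]

/-- The ascent inequality, with the Dirichlet energy of the increment as remainder. -/
theorem dualJ_sub_ge [IsFiniteMeasure μ] [IsFiniteMeasure ν] (hΩ : IsCompact Ω)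
    (hconv : Convex ℝ Ω) (hne : (interior Ω).Nonempty) (hlam : 0 < lam)
    (hφ₀ : φ₀ ∈ HessianClass Ω lam) (hφ₁ : φ₁ ∈ HessianClass Ω lam) (hμ : μ Ωᶜ = 0)
    (hμ_ac : μ ≪ volume) (hbdd : densitySup μ ≠ ⊤) (hρ : pushed Ω μ φ₀ ≪ volume)
    (hE : IntegrableOn (fun x => ‖fderiv ℝ (fun z => φ₁ z - φ₀ z) x‖ ^ 2) Ω volume) :
    ((∫ x in Ω, (φ₁ x - φ₀ x) ∂ν) - ∫ x in Ω, (φ₁ x - φ₀ x) ∂(pushed Ω μ φ₀)) -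
        1 / (2 * lam) * ((densitySup μ).toReal * (lam ^ d)⁻¹ *
          ∫ x in Ω, ‖fderiv ℝ (fun z => φ₁ z - φ₀ z) x‖ ^ 2) ≤
      dualJ Ω μ ν φ₁ - dualJ Ω μ ν φ₀ := by
  have hne' := hne.mono interior_subset
  have hres := restrict_eq_self_of_compl_null hμ
  have hh : ContinuousOn (fun x => φ₁ x - φ₀ x) Ω := hφ₁.1.sub hφ₀.1
  have hT := continuous_transportMap hΩ hconv hne hlam hφ₀
  set D : Space d → ℝ := fun x => ‖fderiv ℝ (fun z => φ₁ z - φ₀ z) x‖ ^ 2 with hD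
  have hDm : Measurable D := by
    exact ((measurable_fderiv ℝ (fun z => φ₁ z - φ₀ z)).norm).pow_const 2
  set C : ℝ≥0∞ := densitySup μ * ENNReal.ofReal ((lam ^ d)⁻¹) with hC
  have hCtop : C ≠ ⊤ := ENNReal.mul_ne_top hbdd ENNReal.ofReal_ne_top
  have hCreal : C.toReal = (densitySup μ).toReal * (lam ^ d)⁻¹ := by
    rw [hC, ENNReal.toReal_mul, ENNReal.toReal_ofReal (by positivity)]
  have hle := pushed_le hΩ hconv hne hlam hφ₀ hμ_ac hρ
  have hEC : Integrable D (C • volume.restrict Ω) := Integrable.smul_measure hE hCtop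
  have hEρ : Integrable D (pushed Ω μ φ₀) := hEC.mono_measure hle
  have hET : Integrable (fun x => D (transportMap Ω φ₀ x)) μ :=
    (integrable_map_measure hDm.aestronglyMeasurable hT.aemeasurable).1 hEρ
  have hbound : ∫ x, D (transportMap Ω φ₀ x) ∂μ ≤
      (densitySup μ).toReal * (lam ^ d)⁻¹ * ∫ x in Ω, D x := by
    rw [← hCreal, ← smul_eq_mul, ← integral_smul_measure,
      ← integral_map hT.aemeasurable hDm.aestronglyMeasurable]
    exact integral_mono_measure hle (Eventually.of_forall fun x => by positivity) hEC
  rw [setIntegral_pushed hΩ hconv hne hlam hφ₀ hh]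
  have i1 := integrable_of_continuous hΩ hμ (continuous_cTransform hΩ hne' hφ₁.1)
  have i2 := integrable_of_continuous hΩ hμ (continuous_cTransform hΩ hne' hφ₀.1)
  have i3 := integrable_of_continuous hΩ hμ
    (continuous_comp_transportMap hΩ hconv hne hlam hφ₀ hh)
  have hint : ∀ᵐ x ∂μ, transportMap Ω φ₀ x ∈ interior Ω :=
    ae_transportMap_mem_interior hΩ hconv hne hlam hφ₀ hρ
  have hmain : ∫ x, -(1 / (2 * lam)) * D (transportMap Ω φ₀ x) ∂μ ≤
      ∫ x, (cTransform Ω φ₁ x - cTransform Ω φ₀ x +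
        (φ₁ (transportMap Ω φ₀ x) - φ₀ (transportMap Ω φ₀ x))) ∂μ := by
    refine integral_mono_ae (hET.const_mul _) ((i1.sub i2).add i3) ?_
    filter_upwards [hint] with x hx
    exact cTransform_remainder_ge hΩ hconv hlam hφ₀ hφ₁ hx
  have hsum : ∫ x, (cTransform Ω φ₁ x - cTransform Ω φ₀ x +
      (φ₁ (transportMap Ω φ₀ x) - φ₀ (transportMap Ω φ₀ x))) ∂μ =
      (∫ x, cTransform Ω φ₁ x ∂μ) - (∫ x, cTransform Ω φ₀ x ∂μ) +
        ∫ x, (φ₁ (transportMap Ω φ₀ x) - φ₀ (transportMap Ω φ₀ x)) ∂μ := by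
    rw [← integral_sub i1 i2]
    exact integral_add (i1.sub i2) i3
  rw [integral_const_mul, hsum] at hmain
  rw [dualJ, dualJ, hres, integral_sub (hφ₁.1.integrableOn_compact hΩ)
    (hφ₀.1.integrableOn_compact hΩ)]
  have := mul_le_mul_of_nonneg_left hbound (by positivity : 0 ≤ 1 / (2 * lam))
  linarith

/-! ### Mollification of Sobolev functions -/

theorem lintegral_mul_sq_le {α : Type*} [MeasurableSpace α] {m : Measure α} {f g : α → ℝ≥0∞}
    (hf : AEMeasurable f m) (hg : AEMeasurable g m) :
    (∫⁻ x, f x * g x ∂m) ^ 2 ≤ (∫⁻ x, f x ^ 2 ∂m) * ∫⁻ x, g x ^ 2 ∂m := by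
  have h := ENNReal.lintegral_mul_le_Lp_mul_Lq m Real.HolderConjugate.two_two hf hg
  simp only [Pi.mul_apply, ENNReal.rpow_two] at h
  refine (pow_le_pow_left' h 2).trans_eq ?_
  rw [mul_pow, ← ENNReal.rpow_two, ← ENNReal.rpow_two, ← ENNReal.rpow_mul, ← ENNReal.rpow_mul]
  norm_num

/-- Mollification of an element of the Sobolev space, extended by zero outside of `Ω`. -/
noncomputable def HDot1.mollify (k : HDot1 Ω) (η : ContDiffBump (0 : Space d)) : Space d → ℝ :=
  convolution (η.normed volume) (Ω.indicator k.toFun) (ContinuousLinearMap.lsmul ℝ ℝ) volume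

theorem HDot1.integrable_indicator (k : HDot1 Ω) (hΩ : MeasurableSet Ω) :
    Integrable (Ω.indicator k.toFun) volume :=
  (integrable_indicator_iff hΩ).2 k.integrableOn

theorem HDot1.contDiff_mollify (k : HDot1 Ω) (hΩ : MeasurableSet Ω)
    (η : ContDiffBump (0 : Space d)) : ContDiff ℝ 1 (k.mollify η) :=
  η.hasCompactSupport_normed.contDiff_convolution_left _ (η.contDiff_normed (n := 1))
    (k.integrable_indicator hΩ).locallyIntegrable

/-- At points whose `η`-neighbourhood lies in the interior, the gradient of the mollification is
the mollification of the weak gradient. -/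
theorem HDot1.fderiv_mollify (k : HDot1 Ω) (hΩ : MeasurableSet Ω) (η : ContDiffBump (0 : Space d))
    {y : Space d} (hy : Metric.closedBall y η.rOut ⊆ interior Ω) (v : Space d) :
    fderiv ℝ (k.mollify η) y v = ∫ z in Ω, inner ℝ (k.grad z) v * η.normed volume (y - z) := by
  have h1 : k.mollify η = convolution (Ω.indicator k.toFun) (η.normed volume)
      (ContinuousLinearMap.lsmul ℝ ℝ).flip volume := by
    rw [mollify, ← convolution_flip]
  have hηd : ContDiff ℝ 1 (η.normed (volume : Measure (Space d))) := η.contDiff_normed (n := 1)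
  have hηc : HasCompactSupport (η.normed (volume : Measure (Space d))) := η.hasCompactSupport_normed
  have hder := hηc.hasFDerivAt_convolution_right (ContinuousLinearMap.lsmul ℝ ℝ).flip
    (k.integrable_indicator hΩ).locallyIntegrable hηd y
  rw [h1, hder.fderiv, convolution_precompR_apply _
    (k.integrable_indicator hΩ).locallyIntegrable (hηc.fderiv ℝ)
    (hηd.continuous_fderiv one_ne_zero), convolution_def]
  have hcomp : ∀ z, HasFDerivAt (fun z => η.normed volume (y - z))
      (-(fderiv ℝ (η.normed volume) (y - z))) z := by
    intro z
    have ha : HasFDerivAt (fun z : Space d => y - z) (-ContinuousLinearMap.id ℝ (Space d)) z := by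
      simpa using (hasFDerivAt_id z).const_sub y
    refine ((hηd.differentiable one_ne_zero (y - z)).hasFDerivAt.comp z ha).congr_fderiv ?_
    ext w; simp
  have hts : tsupport (fun z => η.normed volume (y - z)) ⊆ Metric.closedBall y η.rOut := by
    refine closure_minimal ?_ Metric.isClosed_closedBall
    intro z hz
    have : y - z ∈ Function.support (η.normed volume) := hz
    rw [η.support_normed_eq, mem_ball_zero_iff] at this
    rw [Metric.mem_closedBall, dist_comm, dist_eq_norm]
    exact this.le
  have hw := k.weak_grad (fun z => η.normed volume (y - z))
    ((η.contDiff_normed (n := ⊤)).comp (contDiff_const.sub contDiff_id))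
    ((isCompact_closedBall y η.rOut).of_isClosed_subset (isClosed_tsupport _) hts) (hts.trans hy) v
  simp only [(hcomp _).fderiv, neg_apply, mul_neg, integral_neg, neg_inj] at hw
  rw [← hw, ← integral_indicator hΩ]
  refine integral_congr_ae (Eventually.of_forall fun z => ?_)
  by_cases hz : z ∈ Ω <;> simp [hz, mul_comm]

theorem lintegral_enorm_normed_le (η : ContDiffBump (0 : Space d)) (y : Space d)
    (s : Set (Space d)) : ∫⁻ z in s, ‖η.normed volume (y - z)‖ₑ ≤ 1 := by
  refine (setLIntegral_le_lintegral _ _).trans ?_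
  rw [lintegral_sub_left_eq_self (fun z => ‖η.normed volume z‖ₑ) y,
    ← ofReal_integral_norm_eq_lintegral_enorm η.integrable_normed]
  simp [Real.norm_of_nonneg (η.nonneg_normed _), η.integral_normed]

theorem HDot1.integrable_grad (k : HDot1 Ω) (hΩ : IsCompact Ω) :
    Integrable k.grad (volume.restrict Ω) := by
  have : IsFiniteMeasure (volume.restrict Ω) := ⟨by simpa using hΩ.measure_lt_top⟩
  exact k.grad_memLp.integrable one_le_two

/-- Jensen's inequality for the mollified gradient. -/
theorem HDot1.enorm_fderiv_mollify_sq_le (k : HDot1 Ω) (hΩ : IsCompact Ω)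
    (η : ContDiffBump (0 : Space d)) {y : Space d}
    (hy : Metric.closedBall y η.rOut ⊆ interior Ω) :
    ‖fderiv ℝ (k.mollify η) y‖ₑ ^ 2 ≤
      ∫⁻ z in Ω, ‖k.grad z‖ₑ ^ 2 * ‖η.normed volume (y - z)‖ₑ := by
  have hcont : Continuous (fun z => η.normed volume (y - z)) :=
    η.continuous_normed.comp (continuous_const.sub continuous_id)
  have hint : Integrable (fun z => ‖k.grad z‖ * η.normed volume (y - z)) (volume.restrict Ω) := by
    obtain ⟨B, hB⟩ := η.hasCompactSupport_normed.exists_bound_of_continuous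
      (η.continuous_normed (μ := (volume : Measure (Space d))))
    exact (k.integrable_grad hΩ).norm.mul_bdd (c := B) hcont.aestronglyMeasurable
      (Eventually.of_forall fun z => hB _)
  have h1 : ‖fderiv ℝ (k.mollify η) y‖ ≤ ∫ z in Ω, ‖k.grad z‖ * η.normed volume (y - z) := by
    refine ContinuousLinearMap.opNorm_le_bound _
      (integral_nonneg fun z => mul_nonneg (norm_nonneg _) (η.nonneg_normed _)) fun v => ?_
    rw [k.fderiv_mollify hΩ.measurableSet η hy, ← integral_mul_const]
    refine norm_integral_le_of_norm_le (hint.mul_const _) (Eventually.of_forall fun z => ?_)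
    rw [norm_mul, Real.norm_of_nonneg (η.nonneg_normed _), mul_right_comm]
    exact mul_le_mul_of_nonneg_right (norm_inner_le_norm _ _) (η.nonneg_normed _)
  have h2 : ‖fderiv ℝ (k.mollify η) y‖ₑ ≤
      ∫⁻ z in Ω, ‖k.grad z‖ₑ * ‖η.normed volume (y - z)‖ₑ := by
    calc ‖fderiv ℝ (k.mollify η) y‖ₑ ≤ ‖∫ z in Ω, ‖k.grad z‖ * η.normed volume (y - z)‖ₑ := by
          rw [enorm_le_iff_norm_le]
          exact h1.trans (Real.le_norm_self _)
      _ ≤ ∫⁻ z in Ω, ‖‖k.grad z‖ * η.normed volume (y - z)‖ₑ := enorm_integral_le_lintegral_enorm _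
      _ = _ := by simp only [enorm_mul, enorm_norm]
  have hgm : AEMeasurable (fun z => ‖k.grad z‖ₑ) (volume.restrict Ω) :=
    (k.integrable_grad hΩ).aestronglyMeasurable.enorm
  have hem : Measurable (fun z => ‖η.normed volume (y - z)‖ₑ ^ (1 / 2 : ℝ)) :=
    hcont.measurable.enorm.pow_const _
  have hsq : ∀ z, ‖η.normed volume (y - z)‖ₑ = (‖η.normed volume (y - z)‖ₑ ^ (1 / 2 : ℝ)) ^ 2 := by
    intro z
    rw [← ENNReal.rpow_two, ← ENNReal.rpow_mul]
    norm_num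
  calc ‖fderiv ℝ (k.mollify η) y‖ₑ ^ 2
      ≤ (∫⁻ z in Ω, (‖k.grad z‖ₑ * ‖η.normed volume (y - z)‖ₑ ^ (1 / 2 : ℝ)) *
          ‖η.normed volume (y - z)‖ₑ ^ (1 / 2 : ℝ)) ^ 2 := by
        refine pow_le_pow_left' (h2.trans_eq ?_) 2
        refine lintegral_congr fun z => ?_
        rw [mul_assoc, ← sq, ← hsq]
    _ ≤ (∫⁻ z in Ω, ‖k.grad z‖ₑ ^ 2 * ‖η.normed volume (y - z)‖ₑ) *
          ∫⁻ z in Ω, ‖η.normed volume (y - z)‖ₑ := by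
        refine (lintegral_mul_sq_le (hgm.mul hem.aemeasurable) hem.aemeasurable).trans_eq ?_
        simp only [Pi.mul_apply, mul_pow, ← hsq]
    _ ≤ _ := mul_le_of_le_one_right' (lintegral_enorm_normed_le η y Ω)

/-- Mollification after shrinking `Ω` towards the interior point `x₀`: a smooth approximation of
`k` on all of `Ω`. -/
noncomputable def HDot1.smoothing (k : HDot1 Ω) (η : ContDiffBump (0 : Space d)) (x₀ : Space d)
    (r : ℝ) : Space d → ℝ :=
  fun x => k.mollify η ((1 - r) • x + r • x₀)

/-- The contraction towards the centre of a ball of radius `δ` in `Ω` leaves room of size `r * δ` to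
the boundary. -/
theorem closedBall_shrink_subset (hconv : Convex ℝ Ω) {x₀ : Space d} {δ r ρ : ℝ}
    (hδ : Metric.ball x₀ δ ⊆ Ω) (hr : r ∈ Ioo (0 : ℝ) 1) (hρ : ρ < r * δ) {x : Space d}
    (hx : x ∈ Ω) : Metric.closedBall ((1 - r) • x + r • x₀) ρ ⊆ interior Ω := by
  intro z hz
  rw [mem_closedBall_iff_norm] at hz
  have hw : x₀ + r⁻¹ • (z - ((1 - r) • x + r • x₀)) ∈ interior Ω := by
    refine interior_maximal hδ Metric.isOpen_ball ?_
    rw [mem_ball_iff_norm, add_sub_cancel_left, norm_smul, norm_inv, Real.norm_of_nonneg hr.1.le,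
      inv_mul_lt_iff₀ hr.1]
    exact hz.trans_lt hρ
  have := hconv.combo_self_interior_mem_interior hx hw (sub_nonneg.2 hr.2.le) hr.1 (by ring)
  convert this using 1
  rw [smul_add, smul_smul, mul_inv_cancel₀ hr.1.ne']
  module

/-- The smoothing increases the Dirichlet energy at most by the Jacobian of the contraction. -/
theorem HDot1.lintegral_fderiv_smoothing_le (k : HDot1 Ω) (hΩ : IsCompact Ω) (hconv : Convex ℝ Ω)
    {x₀ : Space d} {δ r : ℝ} (hδ : Metric.ball x₀ δ ⊆ Ω) (hr : r ∈ Ioo (0 : ℝ) 1)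
    {η : ContDiffBump (0 : Space d)} (hη : η.rOut < r * δ) :
    ∫⁻ x in Ω, ‖fderiv ℝ (k.smoothing η x₀ r) x‖ₑ ^ 2 ≤
      ENNReal.ofReal (((1 - r) ^ d)⁻¹) * ∫⁻ x in Ω, ‖k.grad x‖ₑ ^ 2 := by
  have hr' : 0 < 1 - r := sub_pos.2 hr.2
  set S : Space d → Space d := fun x => (1 - r) • x + r • x₀ with hS
  have hSc : Continuous S := by fun_prop
  have hfd : ∀ x, ‖fderiv ℝ (k.smoothing η x₀ r) x‖ₑ ≤ ‖fderiv ℝ (k.mollify η) (S x)‖ₑ := by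
    intro x
    have h1 : HasFDerivAt S ((1 - r) • ContinuousLinearMap.id ℝ (Space d)) x := by
      simpa [hS] using ((hasFDerivAt_id x).const_smul (1 - r)).add_const (r • x₀)
    have h2 := ((k.contDiff_mollify hΩ.measurableSet η).differentiable one_ne_zero
      (S x)).hasFDerivAt.comp x h1
    have h3 : fderiv ℝ (k.smoothing η x₀ r) x = (1 - r) • fderiv ℝ (k.mollify η) (S x) := by
      refine h2.fderiv.trans ?_
      ext v; simp
    rw [h3, enorm_le_iff_norm_le, norm_smul, Real.norm_of_nonneg hr'.le]
    exact mul_le_of_le_one_left (norm_nonneg _) (by linarith [hr.1])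
  have hmap : (volume : Measure (Space d)).map S ≤
      ENNReal.ofReal (((1 - r) ^ d)⁻¹) • volume := by
    have := map_le_of_expanding (S := S) (X := univ) (Ω := univ) (c := 1 - r)
      (m := (volume : Measure (Space d))) (M := 1) (by simp) (by simp) hr' hSc.measurable ?_
    · simpa using this
    · intro x _ x' _
      have : S x - S x' = (1 - r) • (x - x') := by simp only [hS]; module
      rw [this, norm_smul, Real.norm_of_nonneg hr'.le]
  have hηm : Measurable (fun z => ‖η.normed (volume : Measure (Space d)) z‖ₑ) :=
    η.continuous_normed.measurable.enorm
  have hgm : AEMeasurable (fun z => ‖k.grad z‖ₑ) (volume.restrict Ω) :=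
    (k.integrable_grad hΩ).aestronglyMeasurable.enorm
  calc ∫⁻ x in Ω, ‖fderiv ℝ (k.smoothing η x₀ r) x‖ₑ ^ 2
      ≤ ∫⁻ x in Ω, ∫⁻ z in Ω, ‖k.grad z‖ₑ ^ 2 * ‖η.normed volume (S x - z)‖ₑ := by
        refine setLIntegral_mono_ae' hΩ.measurableSet (Eventually.of_forall fun x hx => ?_)
        exact (pow_le_pow_left' (hfd x) 2).trans (k.enorm_fderiv_mollify_sq_le hΩ η
          (closedBall_shrink_subset hconv hδ hr hη hx))
    _ = ∫⁻ z in Ω, ∫⁻ x in Ω, ‖k.grad z‖ₑ ^ 2 * ‖η.normed volume (S x - z)‖ₑ := by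
        refine lintegral_lintegral_swap ?_
        refine ((hgm.comp_snd (μ := volume.restrict Ω)).pow_const 2).mul (Measurable.aemeasurable ?_)
        exact hηm.comp ((hSc.comp continuous_fst).sub continuous_snd).measurable
    _ ≤ ∫⁻ z in Ω, ‖k.grad z‖ₑ ^ 2 * ENNReal.ofReal (((1 - r) ^ d)⁻¹) := by
        refine lintegral_mono fun z => ?_
        have hm : Measurable (fun y => ‖η.normed (volume : Measure (Space d)) (y - z)‖ₑ) :=
          hηm.comp (measurable_id.sub_const z)
        have hmS : Measurable (fun x => ‖η.normed (volume : Measure (Space d)) (S x - z)‖ₑ) :=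
          hm.comp hSc.measurable
        rw [lintegral_const_mul _ hmS]
        gcongr
        refine (setLIntegral_le_lintegral _ _).trans ?_
        refine (lintegral_map hm hSc.measurable).symm.le.trans ?_
        refine (lintegral_mono' hmap le_rfl).trans ?_
        rw [lintegral_smul_measure, smul_eq_mul,
          lintegral_sub_right_eq_self (fun y => ‖η.normed (volume : Measure (Space d)) y‖ₑ) z]
        refine mul_le_of_le_one_right' ?_
        have := lintegral_enorm_normed_le η 0 univ
        simpa [η.normed_neg] using this
    _ = _ := by
        rw [lintegral_mul_const'' _ (hgm.pow_const 2), mul_comm]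

/-! ### Sobolev functions along displacement interpolations -/

/-- Functions of the Sobolev space that are continuous up to the boundary are pointwise limits of
smooth functions without loss of Dirichlet energy. -/
theorem HDot1.exists_smooth_approx (hΩ : IsCompact Ω) (hconv : Convex ℝ Ω)
    (hne : (interior Ω).Nonempty) (k : HDot1 Ω) (hk : ContinuousOn k.toFun Ω) :
    ∃ (K : ℕ → Space d → ℝ) (c : ℕ → ℝ≥0∞), (∀ n, ContDiff ℝ 1 (K n)) ∧
      (∀ x ∈ Ω, Tendsto (fun n => K n x) atTop (𝓝 (k.toFun x))) ∧ Tendsto c atTop (𝓝 1) ∧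
      ∀ n, ∫⁻ x in Ω, ‖fderiv ℝ (K n) x‖ₑ ^ 2 ≤ c n * ∫⁻ x in Ω, ‖k.grad x‖ₑ ^ 2 := by
  obtain ⟨x₀, hx₀⟩ := hne
  obtain ⟨δ, hδ0, hδ⟩ := Metric.isOpen_iff.1 isOpen_interior x₀ hx₀
  replace hδ : Metric.ball x₀ δ ⊆ Ω := hδ.trans interior_subset
  set r : ℕ → ℝ := fun n => 1 / ((n : ℝ) + 2) with hrdef
  have hr : ∀ n, r n ∈ Ioo (0 : ℝ) 1 := by
    intro n
    refine ⟨by positivity, ?_⟩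
    rw [hrdef, div_lt_one (by positivity)]
    have : (0 : ℝ) ≤ n := n.cast_nonneg
    linarith
  have hr0 : Tendsto r atTop (𝓝 0) := by
    have h := (tendsto_one_div_add_atTop_nhds_zero_nat (𝕜 := ℝ)).comp (tendsto_add_atTop_nat 1)
    refine h.congr fun n => ?_
    simp only [Function.comp, hrdef]
    push_cast
    ring_nf
  let η : ∀ n, ContDiffBump (0 : Space d) := fun n =>
    ⟨r n * δ / 4, r n * δ / 2, by have := (hr n).1; positivity,
      by have := mul_pos (hr n).1 hδ0; linarith⟩
  have hη : ∀ n, (η n).rOut < r n * δ := fun n => by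
    have := mul_pos (hr n).1 hδ0
    change r n * δ / 2 < r n * δ
    linarith
  refine ⟨fun n => k.smoothing (η n) x₀ (r n), fun n => ENNReal.ofReal (((1 - r n) ^ d)⁻¹),
    fun n => ?_, fun x hx => ?_, ?_,
    fun n => k.lintegral_fderiv_smoothing_le hΩ hconv hδ (hr n) (hη n)⟩
  · exact (k.contDiff_mollify hΩ.measurableSet (η n)).comp
      (by fun_prop : ContDiff ℝ 1 fun x : Space d => (1 - r n) • x + r n • x₀)
  · set S : ℕ → Space d := fun n => (1 - r n) • x + r n • x₀ with hS
    have hSx : Tendsto S atTop (𝓝 x) := by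
      have : Continuous (fun r : ℝ => (1 - r) • x + r • x₀) := by fun_prop
      simpa using! (this.tendsto 0).comp hr0
    have hsub : ∀ n, Metric.closedBall (S n) (η n).rOut ⊆ Ω := fun n =>
      (closedBall_shrink_subset hconv hδ (hr n) (hη n) hx).trans interior_subset
    have hSΩ : ∀ n, S n ∈ Ω := fun n => hsub n (Metric.mem_closedBall_self (η n).rOut_pos.le)
    have hkS : Tendsto (fun n => k.toFun (S n)) atTop (𝓝 (k.toFun x)) :=
      (hk x hx).tendsto.comp (tendsto_nhdsWithin_iff.2 ⟨hSx, Eventually.of_forall hSΩ⟩)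
    have hdist : Tendsto (fun n => dist (k.smoothing (η n) x₀ (r n) x) (k.toFun (S n))) atTop
        (𝓝 0) := by
      rw [Metric.tendsto_atTop']
      intro ε hε
      obtain ⟨δ', hδ', hball⟩ := Metric.continuousWithinAt_iff.1 (hk x hx) (ε / 4) (by positivity)
      have hout : Tendsto (fun n => dist (S n) x + (η n).rOut) atTop (𝓝 0) := by
        have h1 : Tendsto (fun n => r n * δ / 2) atTop (𝓝 0) := by
          simpa using (hr0.mul_const δ).div_const 2
        simpa using! (tendsto_iff_dist_tendsto_zero.1 hSx).add h1
      obtain ⟨N, hN⟩ := Filter.eventually_atTop.1 (hout.eventually (gt_mem_nhds hδ'))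
      refine ⟨N, fun n hn => ?_⟩
      have hlt := hN n hn.le
      have hclose : ∀ z ∈ Metric.closedBall (S n) (η n).rOut,
          dist (k.toFun z) (k.toFun x) < ε / 4 := by
        intro z hz
        refine hball (hsub n hz) (lt_of_le_of_lt ?_ hlt)
        have := dist_triangle z (S n) x
        rw [Metric.mem_closedBall] at hz
        linarith
      have hS0 := hclose (S n) (Metric.mem_closedBall_self (η n).rOut_pos.le)
      have hfin := (η n).dist_normed_convolution_le (μ := volume) (g := Ω.indicator k.toFun)
        (x₀ := S n) (ε := ε / 2) (k.integrable_indicator hΩ.measurableSet).aestronglyMeasurable ?_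
      · rw [indicator_of_mem (hSΩ n)] at hfin
        rw [Real.dist_0_eq_abs, abs_of_nonneg dist_nonneg]
        exact lt_of_le_of_lt hfin (by linarith)
      · intro z hz
        have hz' := Metric.ball_subset_closedBall hz
        rw [indicator_of_mem (hsub n hz'), indicator_of_mem (hSΩ n)]
        have h1 := hclose z hz'
        have h2 := dist_triangle_right (k.toFun z) (k.toFun (S n)) (k.toFun x)
        linarith
    exact (tendsto_iff_of_dist hdist).2 hkS
  · have h : Tendsto (fun n => ((1 - r n) ^ d)⁻¹) atTop (𝓝 1) := by
      have := ((hr0.const_sub 1).pow d).inv₀ (by simp)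
      simpa using this
    simpa using ENNReal.tendsto_ofReal h

section Displacement

variable {α : Type*} [MeasurableSpace α] {P : Measure α} {Y₀ Y₁ : α → Space d} {C : ℝ≥0∞}

theorem enorm_sub_le_lintegral_fderiv {K : Space d → ℝ} (hK : ContDiff ℝ 1 K) (a b : Space d) :
    ‖K b - K a‖ₑ ≤ ∫⁻ s in Ioc (0 : ℝ) 1, ‖fderiv ℝ K ((1 - s) • a + s • b)‖ₑ * ‖b - a‖ₑ := by
  have hline : ∀ s : ℝ, HasDerivAt (fun s : ℝ => (1 - s) • a + s • b) (b - a) s := by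
    intro s
    have h1 := ((hasDerivAt_id s).const_sub 1).smul_const a
    have h2 := (hasDerivAt_id s).smul_const b
    exact (h1.add h2).congr_deriv (by module)
  have hder : ∀ s : ℝ, HasDerivAt (fun s : ℝ => K ((1 - s) • a + s • b))
      (fderiv ℝ K ((1 - s) • a + s • b) (b - a)) s := fun s =>
    (hK.differentiable one_ne_zero _).hasFDerivAt.comp_hasDerivAt s (hline s)
  have hcont : Continuous fun s : ℝ => fderiv ℝ K ((1 - s) • a + s • b) (b - a) := by
    have : Continuous fun s : ℝ => (1 - s) • a + s • b := by fun_prop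
    exact ((hK.continuous_fderiv one_ne_zero).comp this).clm_apply continuous_const
  have hftc := intervalIntegral.integral_eq_sub_of_hasDerivAt (a := 0) (b := 1)
    (fun s _ => hder s) (hcont.intervalIntegrable 0 1)
  have e : K b - K a = ∫ s in Ioc (0 : ℝ) 1, fderiv ℝ K ((1 - s) • a + s • b) (b - a) := by
    rw [← intervalIntegral.integral_of_le zero_le_one, hftc]
    simp
  rw [e]
  refine (enorm_integral_le_lintegral_enorm _).trans (lintegral_mono fun s => ?_)
  exact ContinuousLinearMap.le_opENorm _ _

/-- Smooth case of the displacement estimate: the fundamental theorem of calculus on the segments from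
`Y₀` to `Y₁`, followed by the Cauchy-Schwarz inequality for each interpolation time. -/
theorem lintegral_sub_sq_le_of_contDiff [SFinite P] (hY₀ : Measurable Y₀) (hY₁ : Measurable Y₁)
    (hC : ∀ s ∈ Icc (0 : ℝ) 1, P.map (fun a => (1 - s) • Y₀ a + s • Y₁ a) ≤ C • volume.restrict Ω)
    {K : Space d → ℝ} (hK : ContDiff ℝ 1 K) :
    (∫⁻ a, ‖K (Y₁ a) - K (Y₀ a)‖ₑ ∂P) ^ 2 ≤
      (C * ∫⁻ x in Ω, ‖fderiv ℝ K x‖ₑ ^ 2) * ∫⁻ a, ‖Y₁ a - Y₀ a‖ₑ ^ 2 ∂P := by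
  obtain ⟨R, hR⟩ : ∃ R, R = (C * ∫⁻ x in Ω, ‖fderiv ℝ K x‖ₑ ^ 2) *
    ∫⁻ a, ‖Y₁ a - Y₀ a‖ₑ ^ 2 ∂P := ⟨_, rfl⟩
  rw [← hR]
  have hKc : Continuous (fderiv ℝ K) := hK.continuous_fderiv one_ne_zero
  obtain ⟨Z, hZ⟩ : ∃ Z : ℝ → α → Space d, Z = fun s a => (1 - s) • Y₀ a + s • Y₁ a := ⟨_, rfl⟩
  have hZm : ∀ s, Measurable (Z s) := fun s => by
    rw [hZ]; exact (hY₀.const_smul (1 - s)).add (hY₁.const_smul s)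
  have hpt : ∀ a, ‖K (Y₁ a) - K (Y₀ a)‖ₑ ≤
      ∫⁻ s in Ioc (0 : ℝ) 1, ‖fderiv ℝ K (Z s a)‖ₑ * ‖Y₁ a - Y₀ a‖ₑ :=
    fun a => by rw [hZ]; exact enorm_sub_le_lintegral_fderiv hK (Y₀ a) (Y₁ a)
  have hjoint : Measurable (Function.uncurry fun (a : α) (s : ℝ) =>
      ‖fderiv ℝ K (Z s a)‖ₑ * ‖Y₁ a - Y₀ a‖ₑ) := by
    have h1 : Measurable (Function.uncurry fun (a : α) (s : ℝ) => Z s a) := by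
      simp only [hZ, Function.uncurry_def]
      exact ((measurable_const.sub measurable_snd).smul (hY₀.comp measurable_fst)).add
        (measurable_snd.smul (hY₁.comp measurable_fst))
    exact (hKc.measurable.comp h1).enorm.mul ((hY₁.sub hY₀).comp measurable_fst).enorm
  have hs : ∀ s ∈ Ioc (0 : ℝ) 1,
      ∫⁻ a, ‖fderiv ℝ K (Z s a)‖ₑ * ‖Y₁ a - Y₀ a‖ₑ ∂P ≤ R ^ (1 / 2 : ℝ) := by
    intro s hs
    have h1 := lintegral_mul_sq_le (m := P) (hKc.measurable.comp (hZm s)).enorm.aemeasurable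
      (hY₁.sub hY₀).enorm.aemeasurable
    have h2 : ∫⁻ a, ‖fderiv ℝ K (Z s a)‖ₑ ^ 2 ∂P ≤ C * ∫⁻ x in Ω, ‖fderiv ℝ K x‖ₑ ^ 2 := by
      rw [← lintegral_map (f := fun x => ‖fderiv ℝ K x‖ₑ ^ 2) (hKc.measurable.enorm.pow_const 2)
        (hZm s), ← smul_eq_mul, ← lintegral_smul_measure]
      have := hC s ⟨hs.1.le, hs.2⟩
      rw [hZ]
      exact lintegral_mono' this le_rfl
    rw [one_div, ENNReal.le_rpow_inv_iff two_pos, ENNReal.rpow_two]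
    rw [hR]
    exact h1.trans (mul_le_mul_left h2 _)
  have hfin : ∫⁻ a, ‖K (Y₁ a) - K (Y₀ a)‖ₑ ∂P ≤ R ^ (1 / 2 : ℝ) := by
    calc ∫⁻ a, ‖K (Y₁ a) - K (Y₀ a)‖ₑ ∂P
        ≤ ∫⁻ a, (∫⁻ s in Ioc (0 : ℝ) 1, ‖fderiv ℝ K (Z s a)‖ₑ * ‖Y₁ a - Y₀ a‖ₑ) ∂P :=
          lintegral_mono hpt
      _ = ∫⁻ s in Ioc (0 : ℝ) 1, (∫⁻ a, ‖fderiv ℝ K (Z s a)‖ₑ * ‖Y₁ a - Y₀ a‖ₑ ∂P) :=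
          lintegral_lintegral_swap hjoint.aemeasurable
      _ ≤ ∫⁻ _s in Ioc (0 : ℝ) 1, R ^ (1 / 2 : ℝ) :=
          setLIntegral_mono' measurableSet_Ioc hs
      _ = R ^ (1 / 2 : ℝ) := by simp
  rwa [one_div, ENNReal.le_rpow_inv_iff two_pos, ENNReal.rpow_two] at hfin

/-- If the laws of all interpolations between `Y₀` and `Y₁` have density at most `C`, then the
increments of a Sobolev function along the displacement from `Y₀` to `Y₁` are controlled by its
Dirichlet energy. -/
theorem HDot1.lintegral_sub_sq_le [SFinite P] (hΩ : IsCompact Ω) (hconv : Convex ℝ Ω)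
    (hne : (interior Ω).Nonempty) (hY₀ : Measurable Y₀) (hY₁ : Measurable Y₁)
    (hY₀Ω : ∀ᵐ a ∂P, Y₀ a ∈ Ω) (hY₁Ω : ∀ᵐ a ∂P, Y₁ a ∈ Ω) (hCtop : C ≠ ⊤)
    (hC : ∀ s ∈ Icc (0 : ℝ) 1, P.map (fun a => (1 - s) • Y₀ a + s • Y₁ a) ≤ C • volume.restrict Ω)
    (k : HDot1 Ω) (hk : ContinuousOn k.toFun Ω) (hD : ∫⁻ a, ‖Y₁ a - Y₀ a‖ₑ ^ 2 ∂P ≠ ⊤)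
    (hE : ∫⁻ x in Ω, ‖k.grad x‖ₑ ^ 2 ≠ ⊤) :
    (∫⁻ a, ‖k.toFun (Y₁ a) - k.toFun (Y₀ a)‖ₑ ∂P) ^ 2 ≤
      (C * ∫⁻ x in Ω, ‖k.grad x‖ₑ ^ 2) * ∫⁻ a, ‖Y₁ a - Y₀ a‖ₑ ^ 2 ∂P := by
  obtain ⟨K, c, hK, hlim, hc, hen⟩ := k.exists_smooth_approx hΩ hconv hne hk
  set E := ∫⁻ x in Ω, ‖k.grad x‖ₑ ^ 2
  set D := ∫⁻ a, ‖Y₁ a - Y₀ a‖ₑ ^ 2 ∂P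
  have h1 : ∫⁻ a, ‖k.toFun (Y₁ a) - k.toFun (Y₀ a)‖ₑ ∂P ≤
      liminf (fun n => ∫⁻ a, ‖K n (Y₁ a) - K n (Y₀ a)‖ₑ ∂P) atTop := by
    refine le_trans (lintegral_mono_ae ?_) (lintegral_liminf_le fun n => ?_)
    · filter_upwards [hY₀Ω, hY₁Ω] with a h0 h1
      exact (((hlim _ h1).sub (hlim _ h0)).enorm).liminf_eq.ge
    · exact (((hK n).continuous.measurable.comp hY₁).sub
        ((hK n).continuous.measurable.comp hY₀)).enorm
  have h2 : ∀ n, ∫⁻ a, ‖K n (Y₁ a) - K n (Y₀ a)‖ₑ ∂P ≤ ((C * (c n * E)) * D) ^ (2⁻¹ : ℝ) := by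
    intro n
    rw [ENNReal.le_rpow_inv_iff two_pos, ENNReal.rpow_two]
    refine (lintegral_sub_sq_le_of_contDiff hY₀ hY₁ hC (hK n)).trans ?_
    gcongr
    exact hen n
  have h3 : Tendsto (fun n => ((C * (c n * E)) * D) ^ (2⁻¹ : ℝ)) atTop
      (𝓝 (((C * E) * D) ^ (2⁻¹ : ℝ))) := by
    refine Tendsto.ennrpow_const _ ?_
    have h4 : Tendsto (fun n => C * (c n * E)) atTop (𝓝 (C * E)) := by
      have := ENNReal.Tendsto.const_mul (ENNReal.Tendsto.mul_const hc (Or.inr hE)) (Or.inr hCtop)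
      simpa using this
    exact ENNReal.Tendsto.mul_const h4 (Or.inr hD)
  have h5 := h1.trans ((liminf_le_liminf (Eventually.of_forall h2)).trans_eq h3.liminf_eq)
  rwa [ENNReal.le_rpow_inv_iff two_pos, ENNReal.rpow_two] at h5

end Displacement

/-! ### The Poincaré inequality -/

theorem HDot1.normSq_eq_innerProd (k : HDot1 Ω) : k.normSq = k.innerProd k := by
  simp only [HDot1.normSq, HDot1.innerProd, real_inner_self_eq_norm_sq]

theorem HDot1.innerProd_eq_inner_toLp (u w : HDot1 Ω) :
    u.innerProd w = inner ℝ (u.grad_memLp.toLp) (w.grad_memLp.toLp) := by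
  rw [L2.inner_def, HDot1.innerProd]
  refine integral_congr_ae ?_
  filter_upwards [u.grad_memLp.coeFn_toLp, w.grad_memLp.coeFn_toLp] with x h1 h2
  rw [h1, h2]

theorem HDot1.normSq_eq_norm_toLp (k : HDot1 Ω) : k.normSq = ‖k.grad_memLp.toLp‖ ^ 2 := by
  rw [normSq_eq_innerProd, innerProd_eq_inner_toLp, real_inner_self_eq_norm_sq]

theorem HDot1.lintegral_grad_sq (k : HDot1 Ω) :
    ∫⁻ x in Ω, ‖k.grad x‖ₑ ^ 2 = eLpNorm k.grad 2 (volume.restrict Ω) ^ 2 := by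
  rw [eLpNorm_eq_lintegral_rpow_enorm_toReal two_ne_zero ENNReal.ofNat_ne_top, ← ENNReal.rpow_two,
    ← ENNReal.rpow_mul]
  simp

theorem isFiniteMeasure_restrict (hΩ : IsCompact Ω) : IsFiniteMeasure (volume.restrict Ω) :=
  ⟨by simpa using hΩ.measure_lt_top⟩

/-- Density bound for the interpolation of two independent uniform points of `Ω`. For each time `s` one
of the weights is at least `1 / 2`, and the interpolation expands distances by this weight in the
corresponding variable. -/
theorem map_prod_interpolation_le (hΩ : IsCompact Ω) (hconv : Convex ℝ Ω) {s : ℝ}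
    (hs : s ∈ Icc (0 : ℝ) 1) :
    ((volume.restrict Ω).prod (volume.restrict Ω)).map
        (fun p : Space d × Space d => (1 - s) • p.1 + s • p.2) ≤
      (ENNReal.ofReal (((1 / 2 : ℝ) ^ d)⁻¹) * volume Ω) • volume.restrict Ω := by
  have := isFiniteMeasure_restrict hΩ
  have key : ∀ s ∈ Icc (1 / 2 : ℝ) 1, ((volume.restrict Ω).prod (volume.restrict Ω)).map
        (fun p : Space d × Space d => (1 - s) • p.1 + s • p.2) ≤
      (ENNReal.ofReal (((1 / 2 : ℝ) ^ d)⁻¹) * volume Ω) • volume.restrict Ω := by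
    intro s hs
    have hm : Measurable (fun p : Space d × Space d => (1 - s) • p.1 + s • p.2) :=
      (by fun_prop : Continuous _).measurable
    refine Measure.le_iff.2 fun A hA => ?_
    rw [Measure.map_apply hm hA, Measure.prod_apply (hm hA)]
    have hx : ∀ x ∈ Ω, (volume.restrict Ω) (Prod.mk x ⁻¹'
        ((fun p : Space d × Space d => (1 - s) • p.1 + s • p.2) ⁻¹' A)) ≤
        ENNReal.ofReal (((1 / 2 : ℝ) ^ d)⁻¹) * (volume.restrict Ω) A := by
      intro x hx
      have hS : Measurable (fun y : Space d => (1 - s) • x + s • y) :=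
        (by fun_prop : Continuous _).measurable
      have h := map_le_of_expanding (S := fun y : Space d => (1 - s) • x + s • y) (X := univ)
        (Ω := Ω) (c := 1 / 2) (m := volume.restrict Ω) (M := 1)
        (by rw [one_smul]; exact Measure.restrict_le_self) ?_ (by norm_num) hS ?_ A
      · rw [Measure.map_apply hS hA, one_mul] at h
        exact h
      · filter_upwards [ae_restrict_mem hΩ.measurableSet] with y hy
        exact ⟨mem_univ _, hconv hx hy (sub_nonneg.2 hs.2) (by linarith [hs.1]) (by ring)⟩
      · intro y _ y' _
        have e : (1 - s) • x + s • y - ((1 - s) • x + s • y') = s • (y - y') := by module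
        rw [e, norm_smul, Real.norm_of_nonneg (by linarith [hs.1])]
        exact mul_le_mul_of_nonneg_right hs.1 (norm_nonneg _)
    calc _ ≤ ∫⁻ _x in Ω, ENNReal.ofReal (((1 / 2 : ℝ) ^ d)⁻¹) * (volume.restrict Ω) A :=
          setLIntegral_mono' hΩ.measurableSet hx
      _ = _ := by
          rw [setLIntegral_const, Measure.smul_apply, smul_eq_mul]
          ring
  rcases le_total (1 / 2) s with h | h
  · exact key s ⟨h, hs.2⟩
  · have h1 := key (1 - s) ⟨by linarith, by linarith [hs.1]⟩
    rw [← Measure.prod_swap, Measure.map_map (by fun_prop) measurable_swap] at h1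
    convert h1 using 2
    ext p : 1
    simp only [Function.comp, Prod.fst_swap, Prod.snd_swap, sub_sub_cancel]
    rw [add_comm]

/-- Poincaré inequality on a compact convex set, for functions of mean zero that are continuous up
to the boundary. -/
theorem exists_poincare (hΩ : IsCompact Ω) (hconv : Convex ℝ Ω) (hne : (interior Ω).Nonempty) :
    ∃ C : ℝ≥0∞, C ≠ ⊤ ∧ ∀ k : HDot1 Ω, ContinuousOn k.toFun Ω →
      eLpNorm k.toFun 1 (volume.restrict Ω) ≤ C * eLpNorm k.grad 2 (volume.restrict Ω) := by
  have := isFiniteMeasure_restrict hΩ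
  obtain ⟨m, hm⟩ : ∃ m : Measure (Space d), m = volume.restrict Ω := ⟨_, rfl⟩
  have hmfin : IsFiniteMeasure m := hm ▸ this
  have hV0 : volume Ω ≠ 0 :=
    ((isOpen_interior.measure_pos volume hne).trans_le (measure_mono interior_subset)).ne'
  have hVtop : volume Ω ≠ ⊤ := hΩ.measure_lt_top.ne
  have hmu : m univ = volume Ω := by rw [hm, Measure.restrict_apply_univ]
  obtain ⟨R, hR⟩ := hΩ.isBounded.exists_norm_le
  have hmem : ∀ᵐ x ∂m, x ∈ Ω := hm ▸ ae_restrict_mem hΩ.measurableSet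
  have hfst : ∀ᵐ p ∂(m.prod m), p.1 ∈ Ω := Measure.quasiMeasurePreserving_fst.ae hmem
  have hsnd : ∀ᵐ p ∂(m.prod m), p.2 ∈ Ω := Measure.quasiMeasurePreserving_snd.ae hmem
  obtain ⟨D, hD⟩ : ∃ D, D = ∫⁻ p, ‖p.2 - p.1‖ₑ ^ 2 ∂(m.prod m) := ⟨_, rfl⟩
  have hDtop : D ≠ ⊤ := by
    have h1 : D ≤ ∫⁻ _p, ENNReal.ofReal (2 * R) ^ 2 ∂(m.prod m) := by
      rw [hD]
      refine lintegral_mono_ae ?_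
      filter_upwards [hfst, hsnd] with p h1 h2
      refine pow_le_pow_left' ?_ 2
      rw [← ofReal_norm]
      refine ENNReal.ofReal_le_ofReal ((norm_sub_le _ _).trans ?_)
      linarith [hR _ h1, hR _ h2]
    refine (h1.trans_lt ?_).ne
    rw [lintegral_const]
    exact ENNReal.mul_lt_top (ENNReal.pow_lt_top ENNReal.ofReal_lt_top) (measure_lt_top _ _)
  obtain ⟨C, hC⟩ : ∃ C, C = ENNReal.ofReal (((1 / 2 : ℝ) ^ d)⁻¹) * volume Ω := ⟨_, rfl⟩
  have hCtop : C ≠ ⊤ := hC ▸ ENNReal.mul_ne_top ENNReal.ofReal_ne_top hVtop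
  refine ⟨(volume Ω)⁻¹ * (C * D) ^ (2⁻¹ : ℝ), ENNReal.mul_ne_top (ENNReal.inv_ne_top.2 hV0)
    (ENNReal.rpow_ne_top_of_nonneg (by norm_num) (ENNReal.mul_ne_top hCtop hDtop)), ?_⟩
  intro k hk
  have hEtop : ∫⁻ x in Ω, ‖k.grad x‖ₑ ^ 2 ≠ ⊤ := by
    rw [k.lintegral_grad_sq]
    exact ENNReal.pow_ne_top k.grad_memLp.2.ne
  have hdisp := k.lintegral_sub_sq_le (P := m.prod m) (Y₀ := Prod.fst) (Y₁ := Prod.snd) (C := C)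
    hΩ hconv hne measurable_fst measurable_snd hfst hsnd hCtop
    (fun s hs => by rw [hm, hC]; exact map_prod_interpolation_le hΩ hconv hs) hk
    (hD ▸ hDtop) hEtop
  rw [← hD, k.lintegral_grad_sq] at hdisp
  have hkm : Integrable k.toFun m := hm ▸ k.integrableOn
  have hmean : ∫ y, k.toFun y ∂m = 0 := hm ▸ k.mean_zero
  -- the mean of `k` is zero, so that `k x` is a mean of differences of values of `k`
  have hpt : ∀ x, ‖k.toFun x‖ₑ * volume Ω ≤ ∫⁻ y, ‖k.toFun y - k.toFun x‖ₑ ∂m := by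
    intro x
    have h1 : ∫ y, (k.toFun y - k.toFun x) ∂m = -(m.real univ * k.toFun x) := by
      rw [integral_sub hkm (integrable_const _), hmean, integral_const, smul_eq_mul, zero_sub]
    have h2 : ‖k.toFun x‖ₑ * volume Ω = ‖∫ y, (k.toFun y - k.toFun x) ∂m‖ₑ := by
      rw [h1, enorm_neg, enorm_mul, mul_comm, ← hmu, Measure.real,
        Real.enorm_of_nonneg ENNReal.toReal_nonneg, ENNReal.ofReal_toReal (measure_ne_top _ _)]
    rw [h2]
    exact enorm_integral_le_lintegral_enorm _
  have hke : AEMeasurable k.toFun m := hkm.aestronglyMeasurable.aemeasurable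
  have hL1 : (∫⁻ x, ‖k.toFun x‖ₑ ∂m) * volume Ω ≤
      ∫⁻ p, ‖k.toFun p.2 - k.toFun p.1‖ₑ ∂(m.prod m) := by
    have hmeas : AEMeasurable (fun p : Space d × Space d => ‖k.toFun p.2 - k.toFun p.1‖ₑ)
        (m.prod m) := (hke.comp_snd.sub hke.comp_fst).enorm
    rw [lintegral_prod _ hmeas, ← lintegral_mul_const'' _ hke.enorm]
    exact lintegral_mono hpt
  have hsqrt : ∫⁻ p, ‖k.toFun p.2 - k.toFun p.1‖ₑ ∂(m.prod m) ≤
      (C * D) ^ (2⁻¹ : ℝ) * eLpNorm k.grad 2 (volume.restrict Ω) := by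
    rw [← ENNReal.rpow_two, ← ENNReal.le_rpow_inv_iff two_pos] at hdisp
    refine hdisp.trans_eq ?_
    rw [mul_right_comm, ENNReal.mul_rpow_of_nonneg _ _ (by norm_num), ← ENNReal.rpow_two,
      ← ENNReal.rpow_mul]
    simp
  rw [eLpNorm_one_eq_lintegral_enorm, ← hm, mul_assoc]
  rw [← hm] at hsqrt
  calc ∫⁻ x, ‖k.toFun x‖ₑ ∂m = (volume Ω)⁻¹ * ((∫⁻ x, ‖k.toFun x‖ₑ ∂m) * volume Ω) := by
        rw [mul_comm _ (volume Ω), ← mul_assoc, ENNReal.inv_mul_cancel hV0 hVtop, one_mul]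
    _ ≤ _ := mul_le_mul_right (hL1.trans hsqrt) _

/-! ### Linear structure of the Sobolev space -/

theorem exists_bound_of_hasCompactSupport {η : Space d → ℝ} (hη : ContDiff ℝ ∞ η)
    (hc : HasCompactSupport η) (v : Space d) :
    ∃ B : ℝ, 0 ≤ B ∧ (∀ x, ‖η x‖ ≤ B) ∧ ∀ x, ‖fderiv ℝ η x v‖ ≤ B := by
  obtain ⟨B₁, h1⟩ := hc.exists_bound_of_continuous hη.continuous
  obtain ⟨B₂, h2⟩ := (hc.fderiv ℝ).exists_bound_of_continuous
    (hη.continuous_fderiv (by simp))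
  refine ⟨max B₁ (B₂ * ‖v‖), (norm_nonneg _).trans ((h1 0).trans (le_max_left _ _)),
    fun x => (h1 x).trans (le_max_left _ _), fun x => ?_⟩
  refine le_trans ?_ (le_max_right _ _)
  exact (ContinuousLinearMap.le_opNorm _ _).trans
    (mul_le_mul_of_nonneg_right (h2 x) (norm_nonneg _))

theorem integrable_mul_fderiv {f η : Space d → ℝ} (hf : IntegrableOn f Ω volume)
    (hη : ContDiff ℝ ∞ η) (hc : HasCompactSupport η) (v : Space d) :
    IntegrableOn (fun x => f x * fderiv ℝ η x v) Ω volume := by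
  obtain ⟨B, -, -, hB⟩ := exists_bound_of_hasCompactSupport hη hc v
  exact Integrable.mul_bdd (c := B) hf
    ((hη.continuous_fderiv (by simp)).clm_apply continuous_const).aestronglyMeasurable
    (Eventually.of_forall hB)

theorem integrable_inner_mul {G : Space d → Space d} {η : Space d → ℝ}
    (hG : Integrable G (volume.restrict Ω)) (hη : ContDiff ℝ ∞ η) (hc : HasCompactSupport η)
    (v : Space d) : IntegrableOn (fun x => inner ℝ (G x) v * η x) Ω volume := by
  obtain ⟨B, -, hB, -⟩ := exists_bound_of_hasCompactSupport hη hc v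
  exact Integrable.mul_bdd (c := B) (hG.inner_const v) hη.continuous.aestronglyMeasurable
    (Eventually.of_forall hB)

theorem HDot1.exists_linear_combination (hΩ : IsCompact Ω) (a b : ℝ) (u w : HDot1 Ω) :
    ∃ q : HDot1 Ω, q.toFun = (fun x => a * u.toFun x + b * w.toFun x) ∧
      q.grad = fun x => a • u.grad x + b • w.grad x := by
  refine ⟨⟨fun x => a * u.toFun x + b * w.toFun x, fun x => a • u.grad x + b • w.grad x,
    (u.integrableOn.const_mul a).add (w.integrableOn.const_mul b), ?_,
    (u.grad_memLp.const_smul a).add (w.grad_memLp.const_smul b), ?_⟩, rfl, rfl⟩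
  · rw [integral_add (u.integrableOn.const_mul a) (w.integrableOn.const_mul b),
      integral_const_mul, integral_const_mul, u.mean_zero, w.mean_zero]
    simp
  · intro η hη hc hs v
    have e1 : ∀ x, (a * u.toFun x + b * w.toFun x) * fderiv ℝ η x v =
        a * (u.toFun x * fderiv ℝ η x v) + b * (w.toFun x * fderiv ℝ η x v) := fun x => by ring
    have e2 : ∀ x, inner ℝ (a • u.grad x + b • w.grad x) v * η x =
        a * (inner ℝ (u.grad x) v * η x) + b * (inner ℝ (w.grad x) v * η x) := fun x => by
      rw [inner_add_left, real_inner_smul_left, real_inner_smul_left]; ring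
    simp only [e1, e2]
    rw [integral_add ((integrable_mul_fderiv u.integrableOn hη hc v).const_mul a)
        ((integrable_mul_fderiv w.integrableOn hη hc v).const_mul b),
      integral_add ((integrable_inner_mul (u.integrable_grad hΩ) hη hc v).const_mul a)
        ((integrable_inner_mul (w.integrable_grad hΩ) hη hc v).const_mul b),
      integral_const_mul, integral_const_mul, integral_const_mul, integral_const_mul,
      u.weak_grad η hη hc hs v, w.weak_grad η hη hc hs v]
    ring

/-- Modification of a Sobolev function and of its gradient on null sets. -/
theorem HDot1.exists_congr (u : HDot1 Ω) {f : Space d → ℝ} {G : Space d → Space d}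
    (hf : f =ᵐ[volume.restrict Ω] u.toFun) (hG : G =ᵐ[volume.restrict Ω] u.grad) :
    ∃ q : HDot1 Ω, q.toFun = f ∧ q.grad = G := by
  refine ⟨⟨f, G, u.integrableOn.congr hf.symm, (integral_congr_ae hf).trans u.mean_zero,
    (memLp_congr_ae hG).2 u.grad_memLp, fun η hη hc hs v => ?_⟩, rfl, rfl⟩
  have h1 : ∫ x in Ω, f x * fderiv ℝ η x v = ∫ x in Ω, u.toFun x * fderiv ℝ η x v :=
    integral_congr_ae (by filter_upwards [hf] with x hx; rw [hx])
  have h2 : ∫ x in Ω, inner ℝ (G x) v * η x = ∫ x in Ω, inner ℝ (u.grad x) v * η x :=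
    integral_congr_ae (by filter_upwards [hG] with x hx; rw [hx])
  rw [h1, h2, u.weak_grad η hη hc hs v]

/-! ### Completeness and the Neumann problem -/

theorem tendsto_integral_of_enorm_sub_le {α : Type*} [MeasurableSpace α] {m : Measure α}
    {F : ℕ → α → ℝ} {f : α → ℝ} {a : ℕ → α → ℝ≥0∞} {B : ℝ≥0∞} (hf : Integrable f m)
    (hF : ∀ n, Integrable (F n) m) (hB : B ≠ ⊤) (hle : ∀ n x, ‖F n x - f x‖ₑ ≤ a n x * B)
    (ha : Tendsto (fun n => ∫⁻ x, a n x ∂m) atTop (𝓝 0)) :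
    Tendsto (fun n => ∫ x, F n x ∂m) atTop (𝓝 (∫ x, f x ∂m)) := by
  refine tendsto_integral_of_L1 f hf.aestronglyMeasurable (Eventually.of_forall hF) ?_
  have h := ENNReal.Tendsto.mul_const ha (Or.inr hB)
  rw [zero_mul] at h
  refine tendsto_of_tendsto_of_tendsto_of_le_of_le tendsto_const_nhds h (fun _ => zero_le) ?_
  intro n
  exact (lintegral_mono (hle n)).trans_eq (lintegral_mul_const' _ _ hB)

/-- Completeness: a limit in `L²` of gradients of continuous Sobolev functions is a gradient. -/
theorem HDot1.exists_grad_eq_of_tendsto (hΩ : IsCompact Ω) (hconv : Convex ℝ Ω)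
    (hne : (interior Ω).Nonempty) {k : ℕ → HDot1 Ω} (hk : ∀ n, ContinuousOn (k n).toFun Ω)
    {G : Lp (Space d) 2 (volume.restrict Ω)}
    (hG : Tendsto (fun n => (k n).grad_memLp.toLp) atTop (𝓝 G)) :
    ∃ w : HDot1 Ω, w.grad = G := by
  have hfin := isFiniteMeasure_restrict hΩ
  obtain ⟨C, hC, hP⟩ := exists_poincare hΩ hconv hne
  have hmem : ∀ n, MemLp (k n).toFun 1 (volume.restrict Ω) := fun n =>
    memLp_one_iff_integrable.2 (k n).integrableOn
  have hdist : ∀ n n', dist ((hmem n).toLp) ((hmem n').toLp) ≤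
      C.toReal * dist ((k n).grad_memLp.toLp) ((k n').grad_memLp.toLp) := by
    intro n n'
    obtain ⟨q, hq, hq'⟩ := HDot1.exists_linear_combination hΩ 1 (-1) (k n) (k n')
    have hqc : ContinuousOn q.toFun Ω := by
      rw [hq]
      exact ((hk n).const_mul 1).add ((hk n').const_mul (-1))
    have h := hP q hqc
    rw [dist_eq_norm, dist_eq_norm, ← MemLp.toLp_sub, ← MemLp.toLp_sub, Lp.norm_toLp, Lp.norm_toLp,
      ← ENNReal.toReal_mul]
    have e1 : q.toFun = (k n).toFun - (k n').toFun := by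
      rw [hq]; ext x; simp [sub_eq_add_neg]
    have e2 : q.grad = (k n).grad - (k n').grad := by
      rw [hq']; ext x : 1; simp [sub_eq_add_neg]
    rw [e1, e2] at h
    exact ENNReal.toReal_mono (ENNReal.mul_ne_top hC
      ((k n).grad_memLp.sub (k n').grad_memLp).2.ne) h
  have hcau : CauchySeq fun n => (hmem n).toLp := by
    rw [Metric.cauchySeq_iff]
    intro ε hε
    obtain ⟨N, hN⟩ := Metric.cauchySeq_iff.1 hG.cauchySeq (ε / (C.toReal + 1)) (by positivity)
    refine ⟨N, fun n hn n' hn' => ?_⟩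
    have h1 := hN n hn n' hn'
    rw [lt_div_iff₀ (by positivity)] at h1
    have h2 := hdist n n'
    nlinarith [dist_nonneg (x := (k n).grad_memLp.toLp) (y := (k n').grad_memLp.toLp)]
  obtain ⟨U, hU⟩ := cauchySeq_tendsto_of_complete hcau
  have hUint : Integrable U (volume.restrict Ω) := L1.integrable_coeFn U
  have hGint : Integrable G (volume.restrict Ω) := (Lp.memLp G).integrable one_le_two
  have hUlim : Tendsto (fun n => ∫⁻ x in Ω, ‖(k n).toFun x - U x‖ₑ) atTop (𝓝 0) := by
    have h := (Lp.tendsto_Lp_iff_tendsto_eLpNorm' _ _).1 hU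
    refine h.congr fun n => ?_
    rw [eLpNorm_one_eq_lintegral_enorm]
    refine lintegral_congr_ae ?_
    filter_upwards [(hmem n).coeFn_toLp] with x hx
    rw [Pi.sub_apply, hx]
  have hGlim : Tendsto (fun n => ∫⁻ x in Ω, ‖(k n).grad x - G x‖ₑ) atTop (𝓝 0) := by
    have h := (Lp.tendsto_Lp_iff_tendsto_eLpNorm' _ _).1 hG
    have h' := ENNReal.Tendsto.mul_const (b := volume Ω ^ (1 / 2 : ℝ)) h
      (Or.inr (ENNReal.rpow_ne_top_of_nonneg (by norm_num) hΩ.measure_lt_top.ne))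
    rw [zero_mul] at h'
    refine tendsto_of_tendsto_of_tendsto_of_le_of_le tendsto_const_nhds h' (fun _ => zero_le) ?_
    intro n
    have h1 := eLpNorm_le_eLpNorm_mul_rpow_measure_univ (μ := volume.restrict Ω) (p := 1) (q := 2)
      (f := ⇑((k n).grad_memLp.toLp) - ⇑G) one_le_two
      ((Lp.aestronglyMeasurable _).sub (Lp.aestronglyMeasurable _))
    rw [Measure.restrict_apply_univ] at h1
    norm_num at h1
    refine le_trans (le_of_eq ?_) (h1.trans_eq (by norm_num))
    rw [eLpNorm_one_eq_lintegral_enorm]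
    refine lintegral_congr_ae ?_
    filter_upwards [(k n).grad_memLp.coeFn_toLp] with x hx
    rw [Pi.sub_apply, hx]
  refine ⟨⟨U, G, hUint, ?_, Lp.memLp G, ?_⟩, rfl⟩
  · have h := tendsto_integral_of_enorm_sub_le hUint (fun n => (k n).integrableOn)
      ENNReal.one_ne_top (fun n x => (mul_one _).ge) hUlim
    simp only [(k _).mean_zero] at h
    exact (tendsto_nhds_unique h tendsto_const_nhds)
  · intro η hη hc hs v
    obtain ⟨B, hB0, hB1, hB2⟩ := exists_bound_of_hasCompactSupport hη hc v
    have hen : ∀ t : ℝ, ‖t‖ ≤ B → ‖t‖ₑ ≤ ENNReal.ofReal B := fun t ht => by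
      rw [← ofReal_norm]; exact ENNReal.ofReal_le_ofReal ht
    have l1 := tendsto_integral_of_enorm_sub_le (m := volume.restrict Ω)
      (F := fun n x => (k n).toFun x * fderiv ℝ η x v) (f := fun x => U x * fderiv ℝ η x v)
      (integrable_mul_fderiv hUint hη hc v)
      (fun n => integrable_mul_fderiv (k n).integrableOn hη hc v)
      (ENNReal.ofReal_ne_top (r := B)) (fun n x => by
        rw [← sub_mul, enorm_mul]
        exact mul_le_mul_right (hen _ (hB2 x)) _) hUlim
    have l2 := tendsto_integral_of_enorm_sub_le (m := volume.restrict Ω)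
      (F := fun n x => inner ℝ ((k n).grad x) v * η x) (f := fun x => inner ℝ (G x) v * η x)
      (B := ‖v‖ₑ * ENNReal.ofReal B)
      (integrable_inner_mul hGint hη hc v)
      (fun n => integrable_inner_mul ((k n).integrable_grad hΩ) hη hc v)
      (ENNReal.mul_ne_top enorm_ne_top ENNReal.ofReal_ne_top) (fun n x => by
        rw [← sub_mul, ← inner_sub_left, enorm_mul, ← mul_assoc]
        refine mul_le_mul' ?_ (hen _ (hB1 x))
        rw [← ofReal_norm, ← ofReal_norm, ← ofReal_norm, ← ENNReal.ofReal_mul (norm_nonneg _)]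
        exact ENNReal.ofReal_le_ofReal (norm_inner_le_norm _ _)) hGlim
    simp only [(k _).weak_grad η hη hc hs v] at l1
    exact tendsto_nhds_unique l1 l2.neg

theorem HDot1.exists_zero : ∃ q : HDot1 Ω, q.toFun = (fun _ => 0) ∧ q.grad = fun _ => 0 :=
  ⟨⟨fun _ => 0, fun _ => 0, integrable_zero _ _ _, by simp, MemLp.zero', by simp⟩, rfl, rfl⟩

/-- The Sobolev functions that are continuous on `Ω`, as pairs of a function and the class of its
weak gradient in `L²`. -/
def continuousSobolev (hΩ : IsCompact Ω) :
    Submodule ℝ ((Space d → ℝ) × Lp (Space d) 2 (volume.restrict Ω)) where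
  carrier := {p | ContinuousOn p.1 Ω ∧ ∃ k : HDot1 Ω, k.toFun = p.1 ∧ k.grad_memLp.toLp = p.2}
  zero_mem' := by
    obtain ⟨q, h1, h2⟩ := HDot1.exists_zero (Ω := Ω)
    refine ⟨continuousOn_const, q, h1, ?_⟩
    have : q.grad =ᵐ[volume.restrict Ω] (0 : Space d → Space d) := by rw [h2]; rfl
    rw [MemLp.toLp_congr q.grad_memLp MemLp.zero this]
    rfl
  add_mem' := by
    rintro ⟨f, F⟩ ⟨g, G⟩ ⟨hf, u, hu, hu'⟩ ⟨hg, w, hw, hw'⟩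
    obtain ⟨q, h1, h2⟩ := HDot1.exists_linear_combination hΩ 1 1 u w
    refine ⟨hf.add hg, q, ?_, ?_⟩
    · simp only [one_mul] at h1
      rw [h1, hu, hw]; rfl
    · simp only at hu' hw'
      rw [Prod.mk_add_mk, ← hu', ← hw', ← MemLp.toLp_add]
      refine MemLp.toLp_congr _ (u.grad_memLp.add w.grad_memLp) ?_
      rw [h2]; simp only [one_smul]; rfl
  smul_mem' := by
    rintro a ⟨f, F⟩ ⟨hf, u, hu, hu'⟩
    obtain ⟨q, h1, h2⟩ := HDot1.exists_linear_combination hΩ a 0 u u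
    refine ⟨hf.const_smul a, q, ?_, ?_⟩
    · simp only [zero_mul, add_zero] at h1
      rw [h1, hu]; rfl
    · simp only at hu'
      rw [Prod.smul_mk, ← hu', ← MemLp.toLp_const_smul]
      refine MemLp.toLp_congr _ (u.grad_memLp.const_smul a) ?_
      rw [h2]; simp only [zero_smul, add_zero]; rfl

/-- Riesz representation: the Neumann problem is solvable as soon as the difference of the measures
is bounded with respect to the Dirichlet norm, and the bound passes to the solution. -/
theorem exists_isNeumannSolution (hΩ : IsCompact Ω) (hconv : Convex ℝ Ω)
    (hne : (interior Ω).Nonempty) (ρ₁ ρ₂ : Measure (Space d)) [IsFiniteMeasure ρ₁]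
    [IsFiniteMeasure ρ₂] {c : ℝ} (hc : 0 ≤ c)
    (hB : ∀ k : HDot1 Ω, ContinuousOn k.toFun Ω →
      |(∫ x in Ω, k.toFun x ∂ρ₂) - ∫ x in Ω, k.toFun x ∂ρ₁| ≤ c * ‖k.grad_memLp.toLp‖) :
    ∃ w : HDot1 Ω, IsNeumannSolution w ρ₁ ρ₂ ∧ w.normSq ≤ c ^ 2 := by
  let W := continuousSobolev hΩ
  let f : W →ₗ[ℝ] ℝ :=
    { toFun := fun p => (∫ x in Ω, p.1.1 x ∂ρ₂) - ∫ x in Ω, p.1.1 x ∂ρ₁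
      map_add' := fun p q => by
        have hp := p.2.1
        have hq := q.2.1
        simp only [Submodule.coe_add, Prod.fst_add, Pi.add_apply]
        rw [integral_add (hp.integrableOn_compact hΩ) (hq.integrableOn_compact hΩ),
          integral_add (hp.integrableOn_compact hΩ) (hq.integrableOn_compact hΩ)]
        ring
      map_smul' := fun a p => by
        simp only [Submodule.coe_smul, Prod.smul_fst, Pi.smul_apply, smul_eq_mul, RingHom.id_apply]
        rw [integral_const_mul, integral_const_mul]
        ring }
  let e : W →ₗ[ℝ] Lp (Space d) 2 (volume.restrict Ω) := (LinearMap.snd ℝ _ _).comp W.subtype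
  let V := (LinearMap.range e).topologicalClosure
  let e' : W →ₗ[ℝ] V := e.codRestrict V fun p =>
    (LinearMap.range e).le_topologicalClosure (LinearMap.mem_range_self e p)
  have hdense : DenseRange e' := by
    rw [DenseRange, Subtype.dense_iff]
    intro x hx
    have hx' : x ∈ closure (LinearMap.range e : Set (Lp (Space d) 2 (volume.restrict Ω))) := hx
    refine closure_mono ?_ hx'
    rintro _ ⟨p, rfl⟩
    exact ⟨e' p, mem_range_self p, rfl⟩
  have hbound : ∀ p : W, ‖f p‖ ≤ c * ‖e' p‖ := by
    intro p
    obtain ⟨hu, k, h1, h2⟩ := p.2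
    have h := hB k (by rw [h1]; exact hu)
    rw [h1, h2] at h
    exact h
  have hVc : CompleteSpace V := (Submodule.isClosed_topologicalClosure _).completeSpace_coe
  let L := f.extendOfNorm e'
  let w₀ := (InnerProductSpace.toDual ℝ V).symm L
  have hw₀ : ‖w₀‖ ≤ c := by
    rw [LinearIsometryEquiv.norm_map]
    exact LinearMap.opNorm_extendOfNorm_le hdense hc hbound
  have hcl : (w₀ : Lp (Space d) 2 (volume.restrict Ω)) ∈
      closure (LinearMap.range e : Set (Lp (Space d) 2 (volume.restrict Ω))) := w₀.2
  -- the representing element is a limit of gradients, hence a gradient itself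
  obtain ⟨p, hp, hlim⟩ := mem_closure_iff_seq_limit.1 hcl
  choose q hq using hp
  choose hqc k hk hk' using fun n => (q n).2
  have hlim' : Tendsto (fun n => (k n).grad_memLp.toLp) atTop (𝓝 (w₀ : Lp (Space d) 2 _)) := by
    refine hlim.congr fun n => ?_
    rw [hk', ← hq]; rfl
  obtain ⟨w, hw⟩ := HDot1.exists_grad_eq_of_tendsto hΩ hconv hne
    (fun n => by rw [hk]; exact hqc n) hlim'
  have hwL : w.grad_memLp.toLp = (w₀ : Lp (Space d) 2 (volume.restrict Ω)) := by
    refine Lp.ext (w.grad_memLp.coeFn_toLp.trans ?_)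
    rw [hw]
  refine ⟨w, fun h hh => ?_, ?_⟩
  · let P : W := ⟨(h.toFun, h.grad_memLp.toLp), hh, h, rfl, rfl⟩
    have h1 : inner ℝ w₀ (e' P) = L (e' P) := InnerProductSpace.toDual_symm_apply
    have h2 : L (e' P) = f P := LinearMap.extendOfNorm_eq hdense ⟨c, hbound⟩ P
    rw [HDot1.innerProd_eq_inner_toLp, hwL]
    exact h1.trans h2
  · rw [w.normSq_eq_norm_toLp, hwL]
    exact pow_le_pow_left₀ (norm_nonneg _) hw₀ 2

/-! ### The gradient step -/

theorem ae_mem_interior (hΩ : IsCompact Ω) (hconv : Convex ℝ Ω) :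
    ∀ᵐ x ∂(volume.restrict Ω), x ∈ interior Ω := by
  have h : ∀ᵐ x ∂(volume.restrict Ω), x ∉ frontier Ω :=
    ae_restrict_of_ae (measure_eq_zero_iff_ae_notMem.1 (hconv.addHaar_frontier volume))
  filter_upwards [h, ae_restrict_mem hΩ.measurableSet] with x h1 h2
  by_contra h3
  exact h1 ⟨subset_closure h2, h3⟩

theorem integrable_mul_of_tsupport_subset {U : Set (Space d)} {f ψ : Space d → ℝ}
    (hf : ContinuousOn f U) (hψ : Continuous ψ) (hc : HasCompactSupport ψ) (hs : tsupport ψ ⊆ U) :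
    Integrable (fun x => f x * ψ x) volume := by
  rw [← integrableOn_iff_integrable_of_support_subset (s := tsupport ψ)]
  · exact ((hf.mono hs).mul hψ.continuousOn).integrableOn_compact hc
  · intro x hx
    exact subset_tsupport ψ (right_ne_zero_of_mul hx)

/-- The weak gradient of a function that is continuously differentiable in the interior is its
classical gradient. -/
theorem HDot1.ae_fderiv_eq (hΩ : IsCompact Ω) (hconv : Convex ℝ Ω) (u : HDot1 Ω)
    (hd : DifferentiableOn ℝ u.toFun (interior Ω))
    (hd' : ContinuousOn (fderiv ℝ u.toFun) (interior Ω)) :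
    ∀ᵐ x ∂(volume.restrict Ω), fderiv ℝ u.toFun x = innerSL ℝ (u.grad x) := by
  have key : ∀ v : Space d, ∀ᵐ x ∂volume, x ∈ interior Ω →
      inner ℝ (u.grad x) v - fderiv ℝ u.toFun x v = 0 := by
    intro v
    have hcv : ContinuousOn (fun x => fderiv ℝ u.toFun x v) (interior Ω) :=
      hd'.clm_apply continuousOn_const
    have hgi : IntegrableOn (fun x => inner ℝ (u.grad x) v) (interior Ω) volume :=
      IntegrableOn.mono_set ((u.integrable_grad hΩ).inner_const v) interior_subset
    refine isOpen_interior.ae_eq_zero_of_integral_contDiff_smul_eq_zero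
      (hgi.locallyIntegrableOn.sub
        (hcv.locallyIntegrableOn isOpen_interior.measurableSet)) fun η hη hc hs => ?_
    have hDc : Continuous (fun x => fderiv ℝ η x v) :=
      (hη.continuous_fderiv (by simp)).clm_apply continuous_const
    have hDs : tsupport (fun x => fderiv ℝ η x v) ⊆ tsupport η :=
      tsupport_fderiv_apply_subset ℝ v
    have hDcs : HasCompactSupport (fun x => fderiv ℝ η x v) :=
      hc.of_isClosed_subset (isClosed_tsupport _) hDs
    have i1 := integrable_mul_of_tsupport_subset hd.continuousOn hDc hDcs (hDs.trans hs)
    have i2 := integrable_mul_of_tsupport_subset hcv hη.continuous hc hs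
    have i3 := integrable_mul_of_tsupport_subset hd.continuousOn hη.continuous hc hs
    have hparts : ∫ x, u.toFun x * fderiv ℝ η x v = -∫ x, fderiv ℝ u.toFun x v * η x :=
      integral_bilinear_hasLineDerivAt_right_eq_neg_left_of_integrable
        (B := ContinuousLinearMap.mul ℝ ℝ) i2 i1 i3
        (fun x hx => ((hd x (hs hx)).differentiableAt
          (isOpen_interior.mem_nhds (hs hx))).hasFDerivAt.hasLineDerivAt v)
        (fun x _ => (hη.differentiable (by simp) x).hasFDerivAt.hasLineDerivAt v)
    have hzero : ∀ x ∉ Ω, η x = 0 := fun x hx =>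
      image_eq_zero_of_notMem_tsupport fun h => hx (interior_subset (hs h))
    have hzero' : ∀ x ∉ Ω, fderiv ℝ η x v = 0 := fun x hx =>
      image_eq_zero_of_notMem_tsupport (f := fun x => fderiv ℝ η x v)
        fun h => hx (interior_subset (hs (hDs h)))
    have hweak := u.weak_grad η hη hc hs v
    rw [setIntegral_eq_integral_of_forall_compl_eq_zero
        (fun x hx => by rw [hzero' x hx, mul_zero]),
      setIntegral_eq_integral_of_forall_compl_eq_zero (fun x hx => by rw [hzero x hx, mul_zero]),
      hparts, neg_inj] at hweak
    have i4 : Integrable (fun x => inner ℝ (u.grad x) v * η x) volume := by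
      rw [← integrableOn_iff_integrable_of_support_subset (s := Ω)]
      · exact integrable_inner_mul (u.integrable_grad hΩ) hη hc v
      · intro x hx
        by_contra h
        exact right_ne_zero_of_mul hx (hzero x h)
    have e : ∀ x, η x • (inner ℝ (u.grad x) v - fderiv ℝ u.toFun x v) =
        inner ℝ (u.grad x) v * η x - fderiv ℝ u.toFun x v * η x := fun x => by
      rw [smul_eq_mul]; ring
    simp only [e]
    rw [integral_sub i4 i2, hweak, sub_self]
  have hall : ∀ᵐ x ∂(volume.restrict Ω), ∀ i : Fin d, x ∈ interior Ω →
      inner ℝ (u.grad x) (EuclideanSpace.basisFun (Fin d) ℝ i) -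
        fderiv ℝ u.toFun x (EuclideanSpace.basisFun (Fin d) ℝ i) = 0 :=
    ae_all_iff.2 fun i => ae_restrict_of_ae (key _)
  filter_upwards [hall, ae_mem_interior hΩ hconv] with x h1 h2
  refine ContinuousLinearMap.coe_injective
    ((EuclideanSpace.basisFun (Fin d) ℝ).toBasis.ext fun i => ?_)
  have := h1 i h2
  simp only [OrthonormalBasis.coe_toBasis, ContinuousLinearMap.coe_coe, innerSL_apply_apply]
  linarith

theorem HDot1.toLp_linear_combination {a b : ℝ} {u w q : HDot1 Ω}
    (hq : q.grad = fun x => a • u.grad x + b • w.grad x) :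
    q.grad_memLp.toLp = a • u.grad_memLp.toLp + b • w.grad_memLp.toLp := by
  rw [← MemLp.toLp_const_smul, ← MemLp.toLp_const_smul, ← MemLp.toLp_add]
  refine MemLp.toLp_congr _ ((u.grad_memLp.const_smul a).add (w.grad_memLp.const_smul b)) ?_
  rw [hq]
  rfl

/-- Solvability of the Neumann problem between two pushforwards, with a bound by the transport
distance of the two maps. -/
theorem exists_isNeumannSolution_pushed [IsFiniteMeasure μ] (hΩ : IsCompact Ω)
    (hconv : Convex ℝ Ω) (hne : (interior Ω).Nonempty) (hlam : 0 < lam)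
    (hφ₀ : φ₀ ∈ HessianClass Ω lam) (hφ₁ : φ₁ ∈ HessianClass Ω lam) (hμ : μ Ωᶜ = 0)
    (hμ_ac : μ ≪ volume) (hbdd : densitySup μ ≠ ⊤) (hρ₀ : pushed Ω μ φ₀ ≪ volume)
    (hρ₁ : pushed Ω μ φ₁ ≪ volume) :
    ∃ w : HDot1 Ω, IsNeumannSolution w (pushed Ω μ φ₀) (pushed Ω μ φ₁) ∧
      w.normSq ≤ (densitySup μ).toReal * (lam ^ d)⁻¹ *
        ∫ x, ‖transportMap Ω φ₁ x - transportMap Ω φ₀ x‖ ^ 2 ∂μ := by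
  have hne' := hne.mono interior_subset
  have hT₀ := continuous_transportMap hΩ hconv hne hlam hφ₀
  have hT₁ := continuous_transportMap hΩ hconv hne hlam hφ₁
  have hfin₀ : IsFiniteMeasure (pushed Ω μ φ₀) := by unfold pushed; infer_instance
  have hfin₁ : IsFiniteMeasure (pushed Ω μ φ₁) := by unfold pushed; infer_instance
  set D := ∫ x, ‖transportMap Ω φ₁ x - transportMap Ω φ₀ x‖ ^ 2 ∂μ with hD
  have hD0 : 0 ≤ D := integral_nonneg fun x => by positivity
  have hDe : ∫⁻ x, ‖transportMap Ω φ₁ x - transportMap Ω φ₀ x‖ₑ ^ 2 ∂μ = ENNReal.ofReal D := by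
    have hDi : Integrable (fun x => ‖transportMap Ω φ₁ x - transportMap Ω φ₀ x‖ ^ 2) μ :=
      integrable_of_continuous hΩ hμ ((hT₁.sub hT₀).norm.pow 2)
    rw [hD, ofReal_integral_eq_lintegral_ofReal hDi (Eventually.of_forall fun x => by positivity)]
    refine lintegral_congr fun x => ?_
    rw [← ofReal_norm, ENNReal.ofReal_pow (norm_nonneg _)]
  set C : ℝ≥0∞ := densitySup μ * ENNReal.ofReal ((lam ^ d)⁻¹) with hC
  have hCtop : C ≠ ⊤ := ENNReal.mul_ne_top hbdd ENNReal.ofReal_ne_top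
  have hCreal : C.toReal = (densitySup μ).toReal * (lam ^ d)⁻¹ := by
    rw [hC, ENNReal.toReal_mul, ENNReal.toReal_ofReal (by positivity)]
  rw [← hCreal, ← Real.sq_sqrt (mul_nonneg ENNReal.toReal_nonneg hD0)]
  refine exists_isNeumannSolution hΩ hconv hne _ _ (Real.sqrt_nonneg _) fun k hk => ?_
  have hk₀ := continuous_comp_transportMap hΩ hconv hne hlam hφ₀ hk
  have hk₁ := continuous_comp_transportMap hΩ hconv hne hlam hφ₁ hk
  rw [setIntegral_pushed hΩ hconv hne hlam hφ₀ hk, setIntegral_pushed hΩ hconv hne hlam hφ₁ hk,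
    ← integral_sub (integrable_of_continuous hΩ hμ hk₁) (integrable_of_continuous hΩ hμ hk₀)]
  have hdisp := k.lintegral_sub_sq_le (P := μ) hΩ hconv hne hT₀.measurable hT₁.measurable
    (Eventually.of_forall (transportMap_mem hΩ hne' hφ₀.1))
    (Eventually.of_forall (transportMap_mem hΩ hne' hφ₁.1)) hCtop
    (fun s hs => map_interpolation_le hΩ hconv hne hlam hφ₀ hφ₁ hμ_ac hρ₀ hρ₁ hs) hk
    (by rw [hDe]; exact ENNReal.ofReal_ne_top)
    (by rw [k.lintegral_grad_sq]; exact ENNReal.pow_ne_top k.grad_memLp.2.ne)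
  rw [hDe, k.lintegral_grad_sq] at hdisp
  have h1 := (pow_le_pow_left' (enorm_integral_le_lintegral_enorm
    (μ := μ) fun x => k.toFun (transportMap Ω φ₁ x) - k.toFun (transportMap Ω φ₀ x)) 2).trans hdisp
  have h2 := ENNReal.toReal_mono (ENNReal.mul_ne_top (ENNReal.mul_ne_top hCtop
    (ENNReal.pow_ne_top k.grad_memLp.2.ne)) ENNReal.ofReal_ne_top) h1
  rw [ENNReal.toReal_mul, ENNReal.toReal_mul, ENNReal.toReal_pow, ENNReal.toReal_pow,
    toReal_enorm, ENNReal.toReal_ofReal hD0, ← Lp.norm_toLp k.grad k.grad_memLp] at h2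
  rw [← Real.norm_eq_abs]
  refine le_of_sq_le_sq ?_ (by positivity)
  rw [mul_pow, Real.sq_sqrt (mul_nonneg ENNReal.toReal_nonneg hD0)]
  linarith

theorem hNegSq_le {ρ₁ ρ₂ : Measure (Space d)} {w : HDot1 Ω} (hw : IsNeumannSolution w ρ₁ ρ₂) :
    hNegSq Ω ρ₁ ρ₂ ≤ ENNReal.ofReal w.normSq :=
  iInf₂_le w hw

theorem HDot1.normSq_nonneg (w : HDot1 Ω) : 0 ≤ w.normSq :=
  integral_nonneg fun _ => by positivity

/-- The increment of the potential in a gradient step, as an element of the Sobolev space. Unlike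
the gradient, which is determined only almost everywhere, it is continuous on `Ω`, and is therefore
an admissible test function. -/
theorem HDot1.exists_increment (hΩ : IsCompact Ω) {σ : ℝ} (g : HDot1 Ω)
    (hstep : ∀ᵐ x ∂(volume.restrict Ω), φ₁ x = φ₀ x + σ * g.toFun x) :
    ∃ u : HDot1 Ω, u.toFun = (fun x => φ₁ x - φ₀ x) ∧
      u.grad_memLp.toLp = σ • g.grad_memLp.toLp := by
  obtain ⟨q, hq, hq'⟩ := HDot1.exists_linear_combination hΩ σ 0 g g
  have hqh : (fun x => φ₁ x - φ₀ x) =ᵐ[volume.restrict Ω] q.toFun := by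
    filter_upwards [hstep] with x hx
    rw [hq, hx]; ring
  obtain ⟨u, hu, hu'⟩ := q.exists_congr hqh (EventuallyEq.refl _ q.grad)
  rw [hq'] at hu'
  have huLp := HDot1.toLp_linear_combination hu'
  rw [zero_smul, add_zero] at huLp
  exact ⟨u, hu, huLp⟩

/-- Ascent of the dual functional in one gradient step. -/
theorem dualJ_gradient_step_ge [IsFiniteMeasure μ] [IsFiniteMeasure ν] (hΩ : IsCompact Ω)
    (hconv : Convex ℝ Ω) (hne : (interior Ω).Nonempty) (hlam : 0 < lam)
    (hφ₀ : φ₀ ∈ HessianClass Ω lam) (hφ₁ : φ₁ ∈ HessianClass Ω lam) (hμ : μ Ωᶜ = 0)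
    (hμ_ac : μ ≪ volume) (hbdd : densitySup μ ≠ ⊤) (hM : 0 < (densitySup μ).toReal)
    (hρ₀ : pushed Ω μ φ₀ ≪ volume) {σ : ℝ} (hσ : σ = (densitySup μ).toReal⁻¹ * lam ^ (d + 1))
    {g : HDot1 Ω} (hg : IsHDot1Gradient (dualJ Ω μ ν) φ₀ g)
    (hstep : ∀ᵐ x ∂(volume.restrict Ω), φ₁ x = φ₀ x + σ * g.toFun x) :
    1 / 2 * σ * g.normSq ≤ dualJ Ω μ ν φ₁ - dualJ Ω μ ν φ₀ := by
  obtain ⟨u, hu, huLp⟩ := g.exists_increment hΩ hstep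
  have hucont : ContinuousOn u.toFun Ω := by rw [hu]; exact hφ₁.1.sub hφ₀.1
  have huv := innerProd_gradient hΩ hconv hne hlam hφ₀ hμ hg u hucont
  rw [HDot1.innerProd_eq_inner_toLp, huLp, real_inner_smul_right, ← HDot1.innerProd_eq_inner_toLp,
    ← HDot1.normSq_eq_innerProd] at huv
  have hd : DifferentiableOn ℝ u.toFun (interior Ω) := by
    rw [hu]
    exact fun x hx => ((hφ₁.2 x hx).1.sub (hφ₀.2 x hx).1).differentiableWithinAt
  have hd' : ContinuousOn (fderiv ℝ u.toFun) (interior Ω) := by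
    rw [hu]
    have : ContinuousOn (fun x => fderiv ℝ φ₁ x - fderiv ℝ φ₀ x) (interior Ω) := fun x hx =>
      ((hφ₁.2 x hx).2.1.continuousAt.sub (hφ₀.2 x hx).2.1.continuousAt).continuousWithinAt
    exact this.congr fun x hx => fderiv_fun_sub (hφ₁.2 x hx).1 (hφ₀.2 x hx).1
  have hfd := u.ae_fderiv_eq hΩ hconv hd hd'
  rw [hu] at hfd
  have hsq : (fun x => ‖fderiv ℝ (fun z => φ₁ z - φ₀ z) x‖ ^ 2) =ᵐ[volume.restrict Ω]
      fun x => ‖u.grad x‖ ^ 2 := by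
    filter_upwards [hfd] with x hx
    rw [hx, innerSL_apply_norm]
  have hE : ∫ x in Ω, ‖fderiv ℝ (fun z => φ₁ z - φ₀ z) x‖ ^ 2 = σ ^ 2 * g.normSq := by
    rw [integral_congr_ae hsq]
    change u.normSq = _
    rw [u.normSq_eq_norm_toLp, huLp, norm_smul, mul_pow, ← g.normSq_eq_norm_toLp,
      Real.norm_eq_abs, sq_abs]
  have hasc := dualJ_sub_ge (ν := ν) hΩ hconv hne hlam hφ₀ hφ₁ hμ hμ_ac hbdd hρ₀
    (((memLp_two_iff_integrable_sq_norm u.grad_memLp.1).1 u.grad_memLp).congr hsq.symm)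
  simp only [hu] at huv
  rw [hE, ← huv] at hasc
  -- the step size is the inverse of the constant in front of the Dirichlet energy
  have hconst : 1 / (2 * lam) * ((densitySup μ).toReal * (lam ^ d)⁻¹ * (σ ^ 2 * g.normSq)) =
      1 / 2 * σ * g.normSq := by
    rw [hσ]; field_simp; ring
  rw [hconst] at hasc
  linarith

/-- Decrease of the negative Sobolev distance to `ν` in one gradient step. With the solution `w` of
the Neumann problem from `ρ₀` to `ρ₁`, the functions `-g` and `w - g` solve the problems from `ν` to
`ρ₀` and to `ρ₁`, and co-coercivity says `‖w‖² ≤ ⟨w, g⟩`. -/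
theorem hNegSq_gradient_step_le [IsFiniteMeasure μ] [IsFiniteMeasure ν] (hΩ : IsCompact Ω)
    (hconv : Convex ℝ Ω) (hne : (interior Ω).Nonempty) (hlam : 0 < lam)
    (hφ₀ : φ₀ ∈ HessianClass Ω lam) (hφ₁ : φ₁ ∈ HessianClass Ω lam) (hμ : μ Ωᶜ = 0)
    (hμ_ac : μ ≪ volume) (hbdd : densitySup μ ≠ ⊤) (hM : 0 < (densitySup μ).toReal)
    (hρ₀ : pushed Ω μ φ₀ ≪ volume) (hρ₁ : pushed Ω μ φ₁ ≪ volume) {σ : ℝ}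
    (hσ : σ = (densitySup μ).toReal⁻¹ * lam ^ (d + 1))
    {g : HDot1 Ω} (hg : IsHDot1Gradient (dualJ Ω μ ν) φ₀ g)
    (hstep : ∀ᵐ x ∂(volume.restrict Ω), φ₁ x = φ₀ x + σ * g.toFun x) :
    hNegSq Ω ν (pushed Ω μ φ₁) ≠ ⊤ ∧ hNegSq Ω ν (pushed Ω μ φ₀) ≠ ⊤ ∧
      hNegSq Ω (pushed Ω μ φ₀) (pushed Ω μ φ₁) ≠ ⊤ ∧
      (hNegSq Ω ν (pushed Ω μ φ₁)).toReal - (hNegSq Ω ν (pushed Ω μ φ₀)).toReal ≤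
        -(hNegSq Ω (pushed Ω μ φ₀) (pushed Ω μ φ₁)).toReal := by
  obtain ⟨u, hu, huLp⟩ := g.exists_increment hΩ hstep
  have hucont : ContinuousOn u.toFun Ω := by rw [hu]; exact hφ₁.1.sub hφ₀.1
  have hvar := innerProd_gradient hΩ hconv hne hlam hφ₀ hμ hg
  have huv := hvar u hucont
  rw [HDot1.innerProd_eq_inner_toLp, huLp, real_inner_smul_right, ← HDot1.innerProd_eq_inner_toLp,
    ← HDot1.normSq_eq_innerProd] at huv
  have hσ0 : 0 < σ := by rw [hσ]; positivity
  obtain ⟨w, hw, hwle⟩ := exists_isNeumannSolution_pushed hΩ hconv hne hlam hφ₀ hφ₁ hμ hμ_ac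
    hbdd hρ₀ hρ₁
  obtain ⟨W, -, hW⟩ := HDot1.exists_linear_combination hΩ 1 (-1) w g
  obtain ⟨G, -, hG⟩ := HDot1.exists_linear_combination hΩ (-1) 0 g g
  have hWLp := HDot1.toLp_linear_combination hW
  have hGLp := HDot1.toLp_linear_combination hG
  have hWsol : IsNeumannSolution W ν (pushed Ω μ φ₁) := by
    intro k hk
    have h1 := hw k hk
    have h2 := hvar k hk
    rw [HDot1.innerProd_eq_inner_toLp] at h1 h2 ⊢
    rw [hWLp, inner_add_left, real_inner_smul_left, real_inner_smul_left, h1, h2]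
    ring
  have hGsol : IsNeumannSolution G ν (pushed Ω μ φ₀) := by
    intro k hk
    have h2 := hvar k hk
    rw [HDot1.innerProd_eq_inner_toLp] at h2 ⊢
    rw [hGLp, inner_add_left, real_inner_smul_left, real_inner_smul_left, h2]
    ring
  -- a solution `w'` satisfies `⟨w', g⟩ = -‖g‖²`, by testing with `u`, hence `‖g‖ ≤ ‖w'‖`
  have hmin : ENNReal.ofReal g.normSq ≤ hNegSq Ω ν (pushed Ω μ φ₀) := by
    refine le_iInf₂ fun w' hw' => ENNReal.ofReal_le_ofReal ?_
    have h1 := hw' u hucont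
    rw [HDot1.innerProd_eq_inner_toLp, huLp, real_inner_smul_right] at h1
    have h2 : inner ℝ w'.grad_memLp.toLp g.grad_memLp.toLp = -g.normSq := by
      have : σ * (inner ℝ w'.grad_memLp.toLp g.grad_memLp.toLp) = σ * (-g.normSq) := by linarith
      exact mul_left_cancel₀ hσ0.ne' this
    have h3 := norm_add_sq_real w'.grad_memLp.toLp g.grad_memLp.toLp
    rw [h2, ← HDot1.normSq_eq_norm_toLp, ← HDot1.normSq_eq_norm_toLp] at h3
    nlinarith [sq_nonneg ‖w'.grad_memLp.toLp + g.grad_memLp.toLp‖]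
  -- integrate the strong convexity estimate and compare with the bound for `‖w‖²`
  have hco : w.normSq ≤ inner ℝ w.grad_memLp.toLp g.grad_memLp.toLp := by
    have h1 := hw u hucont
    rw [HDot1.innerProd_eq_inner_toLp, huLp, real_inner_smul_right,
      setIntegral_pushed hΩ hconv hne hlam hφ₀ hucont,
      setIntegral_pushed hΩ hconv hne hlam hφ₁ hucont] at h1
    have hT₀ := continuous_transportMap hΩ hconv hne hlam hφ₀
    have hT₁ := continuous_transportMap hΩ hconv hne hlam hφ₁
    have hk₀ := integrable_of_continuous hΩ hμ (continuous_comp_transportMap hΩ hconv hne hlam hφ₀ hucont)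
    have hk₁ := integrable_of_continuous hΩ hμ (continuous_comp_transportMap hΩ hconv hne hlam hφ₁ hucont)
    rw [← integral_sub hk₁ hk₀] at h1
    have h2 : lam * ∫ x, ‖transportMap Ω φ₁ x - transportMap Ω φ₀ x‖ ^ 2 ∂μ ≤
        ∫ x, (u.toFun (transportMap Ω φ₁ x) - u.toFun (transportMap Ω φ₀ x)) ∂μ := by
      rw [← integral_const_mul]
      refine integral_mono ((integrable_of_continuous hΩ hμ
        ((hT₁.sub hT₀).norm.pow 2)).const_mul lam) (hk₁.sub hk₀)
        fun x => ?_
      simp only [hu]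
      exact sub_transportMap_ge hΩ hconv hne hφ₀ hφ₁ x
    rw [← h1] at h2
    have h3 := mul_le_mul_of_nonneg_left h2 (by positivity : 0 ≤ (densitySup μ).toReal * (lam ^ (d + 1))⁻¹)
    have h4 : (densitySup μ).toReal * (lam ^ (d + 1))⁻¹ * σ = 1 := by rw [hσ]; field_simp
    have h5 : (densitySup μ).toReal * (lam ^ (d + 1))⁻¹ * lam =
        (densitySup μ).toReal * (lam ^ d)⁻¹ := by field_simp; ring
    rw [← mul_assoc, ← mul_assoc, h4, h5, one_mul] at h3
    exact hwle.trans h3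
  have hWn : W.normSq = w.normSq - 2 * inner ℝ w.grad_memLp.toLp g.grad_memLp.toLp + g.normSq := by
    rw [W.normSq_eq_norm_toLp, w.normSq_eq_norm_toLp, g.normSq_eq_norm_toLp, hWLp, one_smul,
      neg_one_smul, ← sub_eq_add_neg, norm_sub_sq_real]
  have t1 : hNegSq Ω ν (pushed Ω μ φ₁) ≠ ⊤ := ne_top_of_le_ne_top ENNReal.ofReal_ne_top
    (hNegSq_le hWsol)
  have t2 : hNegSq Ω ν (pushed Ω μ φ₀) ≠ ⊤ := ne_top_of_le_ne_top ENNReal.ofReal_ne_top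
    (hNegSq_le hGsol)
  have t3 : hNegSq Ω (pushed Ω μ φ₀) (pushed Ω μ φ₁) ≠ ⊤ :=
    ne_top_of_le_ne_top ENNReal.ofReal_ne_top (hNegSq_le hw)
  refine ⟨t1, t2, t3, ?_⟩
  have b1 := ENNReal.toReal_le_of_le_ofReal W.normSq_nonneg (hNegSq_le hWsol)
  have b2 := (ENNReal.ofReal_le_iff_le_toReal t2).1 hmin
  have b3 := ENNReal.toReal_le_of_le_ofReal w.normSq_nonneg (hNegSq_le hw)
  linarith

end BackForth

theorem proposition3p2 {d : ℕ} {Ω : Set (Space d)} (hΩ_compact : IsCompact Ω)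
    (hΩ_convex : Convex ℝ Ω)
    (μ ν : Measure (Space d)) [IsProbabilityMeasure μ] [IsProbabilityMeasure ν]
    (hμ_supp : μ Ωᶜ = 0) (hν_supp : ν Ωᶜ = 0)
    (hμ_ac : μ ≪ volume) (hν_ac : ν ≪ volume) (hμ_bdd : densitySup μ ≠ ⊤)
    (lam : ℝ) (hlam : 0 < lam) (σ : ℝ) (hσ : σ = (densitySup μ).toReal⁻¹ * lam ^ (d + 1))
    -- the iterates with indices `n` and `n + 1/2`, and the gradients of `J` at the former
    (φ φhalf : ℕ → Space d → ℝ) (g : ℕ → HDot1 Ω)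
    (hφ : ∀ n, φ n ∈ HessianClass Ω lam) (hφhalf : ∀ n, φhalf n ∈ HessianClass Ω lam)
    (hρ : ∀ n, pushed Ω μ (φ n) ≪ volume)
    (hg : ∀ n, IsHDot1Gradient (dualJ Ω μ ν) (φ n) (g n))
    (hstep : ∀ n, ∀ᵐ x ∂(volume.restrict Ω), φhalf n x = φ n x + σ * (g n).toFun x) :
    ∀ n,
      dualJ Ω μ ν (φhalf n) - dualJ Ω μ ν (φ n) ≥
          (1 / 2) * (densitySup μ).toReal⁻¹ * lam ^ (d + 1) * (g n).normSq ∧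
      (pushed Ω μ (φhalf n) ≪ volume →
        hNegSq Ω ν (pushed Ω μ (φhalf n)) ≠ ⊤ ∧
        hNegSq Ω ν (pushed Ω μ (φ n)) ≠ ⊤ ∧
        hNegSq Ω (pushed Ω μ (φ n)) (pushed Ω μ (φhalf n)) ≠ ⊤ ∧
        (hNegSq Ω ν (pushed Ω μ (φhalf n))).toReal - (hNegSq Ω ν (pushed Ω μ (φ n))).toReal ≤
          -(hNegSq Ω (pushed Ω μ (φ n)) (pushed Ω μ (φhalf n))).toReal) := by
  intro n
  have hne := nonempty_interior_of_ac hΩ_convex hμ_ac hμ_supp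
  have hM : 0 < (densitySup μ).toReal := ENNReal.toReal_pos (densitySup_ne_zero hμ_ac) hμ_bdd
  refine ⟨?_, fun hρ₁ => hNegSq_gradient_step_le hΩ_compact hΩ_convex hne hlam (hφ n) (hφhalf n)
    hμ_supp hμ_ac hμ_bdd hM (hρ n) hρ₁ hσ (hg n) (hstep n)⟩
  have h := dualJ_gradient_step_ge hΩ_compact hΩ_convex hne hlam (hφ n) (hφhalf n) hμ_supp hμ_ac
    hμ_bdd hM (hρ n) hσ (hg n) (hstep n)
  rw [hσ, ← mul_assoc] at h
  exact h
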